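/- **Setting.** Let $W=(W^1,W^2)$ be a two-dimensional Brownian motion on a complete probability space $(\Omega,\mathcal F,\mathbb P)$ with its augmented Brownian filtration $\mathbb F=(\mathcal F_t)_{t\ge 0}$. Let $\mu$ and $\sigma>0$ be $\mathbb F$-progressively measurable real processes such that the market price of risk $\theta=\mu/\sigma$ is uniformly bounded. For a bounded stopping time $\tau$ and $0\le t\le\tau$, let $\mathcal A_{[t,\tau]}$ be the set of real $\mathbb F$-progressively measurable processes $\pi$ for which there is a constant $C>0$ with $\mathbb E[\int_\sigma^\tau|\pi_r|^2dr\,|\,\mathcal F_\sigma]\le C$ a.s. for all stopping times $\sigma$ valued in $[t,\tau]$. Conditional expectations below are $\mathbb E[X^+|\mathcal F_t]-\mathbb E[X^-|\mathcal F_t]\in[-\infty,\infty]$, with value $-\infty$ where both terms are infinite. Let $U(t,x)$, $t\ge0$, $x\in\mathbb R$, be a forward performance process, that is: $U(\cdot,x)$ is $\mathbb F$-progressively measurable for each $x$; for each $t$, a.s., $x\mapsto U(t,x)$ is strictly increasing and strictly concave; and for every bounded stopping time $\tau$, every $0\le t\le\tau$ and every $\xi\in\bigcap_{1\le p<\infty}L^p(\mathcal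 F_t)$, $$U(t,\xi)=\operatorname*{esssup}_{\pi\in\mathcal A_{[t,\tau]}}\mathbb E\Big[U\Big(\tau,\xi+\int_t^\tau\pi_r(\theta_rdr+dW^1_r)\Big)\Big|\mathcal F_t\Big]\quad\text{a.s.}$$ Assume moreover that for each $t$, a.s., $x\mapsto U(t,x)$ is three times continuously differentiable, and that there are constants $0<C_l\le C_u$ such that a.s. $C_l\le -U_x(t,x)/U_{xx}(t,x)\le C_u$ for all $(t,x)$. Let $T>0$ and $0\le t\le T$, and let $\eta$ be a positive $\mathcal F_t$-measurable random variable with $\mathbb E[\eta]=1$. For an $\mathcal F_T$-measurable random variable $P$, the forward optimized certainty equivalent is $$F(t,P;\eta,T)=\operatorname*{esssup}_{\xi\in\bigcap_{1\le p<\infty}L^p(\mathcal F_t)}\Big(\operatorname*{esssup}_{\pi\in\mathcal A_{[t,T]}}\mathbb E\Big[U\Big(T,\xi+\int_t^T\pi_r(\theta_rdr+dW^1_r)+P\Big)\Big|\mathcal F_t\Big]-\xi\eta\Big),$$ and its normalized version is $\tilde F(t,P;\eta,T)=F(t,P;\eta,T)-F(t,0;\eta,T)$. **Proposition.** The following hold,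 all (in)equalities being a.s. 1. *Monotonicity.* If $P^1,P^2\in L^\infty(\mathcal F_T)$ and $P^1\ge P^2$, then $F(t,P^1;\eta,T)\ge F(t,P^2;\eta,T)$. 2. *Cash invariance.* If $P\in L^\infty(\mathcal F_T)$ and $c\in L^\infty(\mathcal F_t)$, then $F(t,P+c;\eta,T)=F(t,P;\eta,T)+\eta c$. 3. *Concavity.* If $P^1,P^2\in L^\infty(\mathcal F_T)$ and $\lambda\in L^\infty(\mathcal F_t)$ is valued in $(0,1)$, then $$\lambda F(t,P^1;\eta,T)+(1-\lambda)F(t,P^2;\eta,T)\le F(t,\lambda P^1+(1-\lambda)P^2;\eta,T).$$ 4. *Replication invariance.* If $P\in L^\infty(\mathcal F_T)$ and $\pi\in\mathcal A_{[t,T]}$, then $F\big(t,P+\int_t^T\pi_r(\theta_rdr+dW^1_r);\eta,T\big)=F(t,P;\eta,T)$. 5. *Positivity.* If $P\in L^\infty(\mathcal F_T)$ and $P\ge0$, then $\tilde F(t,P;\eta,T)\ge0$. 6. *Constancy.* If $c\in L^\infty(\mathcal F_t)$, then $\tilde F(t,c;\eta,T)=\eta c$. -/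

import Mathlib

open MeasureTheory ProbabilityTheory Filter Set
open scoped NNReal ENNReal Topology

namespace ForwardOCE

noncomputable section

/-! ### Essential suprema of families of random variables -/

/-- `Y` is the essential supremum, among `m`-measurable extended random variables, of the
family `S`: an almost sure upper bound of `S` that is almost surely below any other one. -/
structure IsEssSup {Ω : Type*} {m0 : MeasurableSpace Ω} (μ : Measure Ω) (m : MeasurableSpace Ω)
    (S : Set (Ω → EReal)) (Y : Ω → EReal) : Prop where
  measurable : Measurable[m] Y
  le : ∀ f ∈ S, f ≤ᵐ[μ] Y
  least : ∀ Z : Ω → EReal, Measurable[m] Z → (∀ f ∈ S, f ≤ᵐ[μ] Z) → Y ≤ᵐ[μ] Z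

/-- A bounded strictly increasing gauge of the extended reals. -/
def gauge (x : EReal) : ℝ≥0∞ :=
  ENNReal.ofReal (ENNReal.orderIsoUnitIntervalBirational (EReal.expOrderIso x) : ℝ)

theorem gauge_strictMono : StrictMono gauge := by
  intro x y h
  have h1 : ENNReal.orderIsoUnitIntervalBirational (EReal.expOrderIso x) <
      ENNReal.orderIsoUnitIntervalBirational (EReal.expOrderIso y) := by simpa using h
  have h2 : ((ENNReal.orderIsoUnitIntervalBirational (EReal.expOrderIso x) : Set.Icc (0:ℝ) 1) : ℝ)
      < (ENNReal.orderIsoUnitIntervalBirational (EReal.expOrderIso y) : Set.Icc (0:ℝ) 1) := h1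
  have h3 : (0:ℝ) ≤
      (ENNReal.orderIsoUnitIntervalBirational (EReal.expOrderIso x) : Set.Icc (0:ℝ) 1) :=
    (ENNReal.orderIsoUnitIntervalBirational (EReal.expOrderIso x)).2.1
  exact (ENNReal.ofReal_lt_ofReal_iff (lt_of_le_of_lt h3 h2)).2 h2

theorem gauge_le_one (x : EReal) : gauge x ≤ 1 := by
  have h := (ENNReal.orderIsoUnitIntervalBirational (EReal.expOrderIso x)).2.2
  unfold gauge
  rw [← ENNReal.ofReal_one]
  exact ENNReal.ofReal_le_ofReal h

theorem exists_isEssSup {Ω : Type*} {m0 : MeasurableSpace Ω} (μ : Measure Ω) [IsFiniteMeasure μ]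
    {m : MeasurableSpace Ω} (hm : m ≤ m0) (S : Set (Ω → EReal)) : ∃ Y, IsEssSup μ m S Y := by
  classical
  have hg : Measurable gauge := gauge_strictMono.monotone.measurable
  let B : Set (Ω → EReal) := {Z | Measurable[m] Z ∧ ∀ f ∈ S, f ≤ᵐ[μ] Z}
  have hB : (fun _ => ⊤ : Ω → EReal) ∈ B :=
    ⟨measurable_const, fun f _ => Eventually.of_forall fun _ => le_top⟩
  let J : (Ω → EReal) → ℝ≥0∞ := fun Z => ∫⁻ ω, gauge (Z ω) ∂μ
  have hne : (J '' B).Nonempty := ⟨_, _, hB, rfl⟩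
  obtain ⟨u, -, hu, huB⟩ := exists_seq_tendsto_sInf hne (OrderBot.bddBelow _)
  choose Z hZ hJZ using huB
  let Y : Ω → EReal := fun ω => ⨅ n, Z n ω
  have hYm : Measurable[m] Y := Measurable.iInf fun n => (hZ n).1
  have hYB : Y ∈ B := by
    refine ⟨hYm, fun f hf => ?_⟩
    have : ∀ᵐ ω ∂μ, ∀ n, f ω ≤ Z n ω := ae_all_iff.2 fun n => (hZ n).2 f hf
    filter_upwards [this] with ω hω using le_iInf hω
  have hYJ : J Y ≤ sInf (J '' B) := by
    refine ge_of_tendsto' hu fun n => ?_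
    rw [← hJZ n]
    exact lintegral_mono fun ω => gauge_strictMono.monotone (iInf_le _ n)
  refine ⟨Y, hYm, hYB.2, fun V hV hVS => ?_⟩
  let X : Ω → EReal := fun ω => Y ω ⊓ V ω
  have hXm : Measurable[m] X := Measurable.min hYm hV
  have hXB : X ∈ B := by
    refine ⟨hXm, fun f hf => ?_⟩
    filter_upwards [hYB.2 f hf, hVS f hf] with ω h1 h2 using le_inf h1 h2
  have hYX : J Y ≤ J X := hYJ.trans (sInf_le ⟨X, hXB, rfl⟩)
  have hfin : J X ≠ ⊤ := by
    refine ne_top_of_le_ne_top (measure_ne_top μ univ) ?_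
    calc J X ≤ ∫⁻ _, 1 ∂μ := lintegral_mono fun ω => gauge_le_one _
      _ = μ univ := by simp
  have hae : (fun ω => gauge (X ω)) =ᵐ[μ] fun ω => gauge (Y ω) :=
    ae_eq_of_ae_le_of_lintegral_le
      (Eventually.of_forall fun ω => gauge_strictMono.monotone inf_le_left) hfin
      (hg.comp (hYm.mono hm le_rfl)).aemeasurable hYX
  filter_upwards [hae] with ω hω
  have h1 : X ω = Y ω := gauge_strictMono.injective hω
  rw [← h1]
  exact inf_le_right

/-- A version of the essential supremum of the family `S`, measurable with respect to `m`. -/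
def essSupFamily {Ω : Type*} {m0 : MeasurableSpace Ω} (μ : Measure Ω) [IsFiniteMeasure μ]
    {m : MeasurableSpace Ω} (hm : m ≤ m0) (S : Set (Ω → EReal)) : Ω → EReal :=
  (exists_isEssSup μ hm S).choose

theorem isEssSup_essSupFamily {Ω : Type*} {m0 : MeasurableSpace Ω} (μ : Measure Ω)
    [IsFiniteMeasure μ] {m : MeasurableSpace Ω} (hm : m ≤ m0) (S : Set (Ω → EReal)) :
    IsEssSup μ m S (essSupFamily μ hm S) :=
  (exists_isEssSup μ hm S).choose_spec

/-- Generalized conditional expectation `E[X⁺ | m] - E[X⁻ | m]` of a real random variable, with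
values in `[-∞, ∞]`. It is the usual conditional expectation for integrable `X`; where both
terms are infinite the value is `-∞`, as `⊤ - ⊤ = ⊥` in `EReal`. -/
def genCondExp {Ω : Type*} {m0 : MeasurableSpace Ω} (μ : Measure Ω) (m : MeasurableSpace Ω)
    (X : Ω → ℝ) : Ω → EReal := fun ω =>
  (condLExp m μ (fun ω' => ENNReal.ofReal (X ω')) ω : EReal)
    - (condLExp m μ (fun ω' => ENNReal.ofReal (-X ω')) ω : EReal)

/-! ### The Brownian filtration and the Itô integral -/

/-- The filtration generated by `W` and augmented by all null sets. -/
def brownianFiltration {Ω : Type*} {m0 : MeasurableSpace Ω} (μ : Measure Ω) [μ.IsComplete]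
    (W : Fin 2 → ℝ≥0 → Ω → ℝ) (hW : ∀ i s, Measurable (W i s)) : Filtration ℝ≥0 m0 where
  seq t := (⨆ (i : Fin 2) (s : ℝ≥0) (_ : s ≤ t), MeasurableSpace.comap (W i s) inferInstance) ⊔
    MeasurableSpace.generateFrom {A | μ A = 0}
  mono' t t' h := by
    refine sup_le_sup_right (iSup_mono fun i => iSup_mono fun s => ?_) _
    exact iSup_le fun hs => le_iSup_of_le (hs.trans h) le_rfl
  le' t := by
    refine sup_le (iSup_le fun i => iSup_le fun s => iSup_le fun _ => (hW i s).comap_le) ?_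
    exact MeasurableSpace.generateFrom_le fun A hA => Measure.IsComplete.out' A hA

/-- An elementary integrand `coef · 1_{(left, right]}` living after time `t`, with `coef` bounded
and known at time `left`. -/
structure ElemStep {Ω : Type*} {m0 : MeasurableSpace Ω} (𝓕 : Filtration ℝ≥0 m0) (t : ℝ≥0) where
  left : ℝ≥0
  right : ℝ≥0
  le_left : t ≤ left
  left_le_right : left ≤ right
  coef : Ω → ℝ
  measurable_coef : Measurable[𝓕 left] coef
  bounded_coef : ∃ C : ℝ, ∀ ω, |coef ω| ≤ C

/-- The value at time `r` of the simple process given by a finite list of elementary steps. -/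
def simpleValue {Ω : Type*} {m0 : MeasurableSpace Ω} {𝓕 : Filtration ℝ≥0 m0} {t : ℝ≥0}
    (H : List (ElemStep 𝓕 t)) (r : ℝ≥0) (ω : Ω) : ℝ :=
  (H.map fun s => (Ioc s.left s.right).indicator (fun _ => s.coef ω) r).sum

/-- The stochastic integral of a simple process against `B`. -/
def simpleIntegral {Ω : Type*} {m0 : MeasurableSpace Ω} {𝓕 : Filtration ℝ≥0 m0} {t : ℝ≥0}
    (B : ℝ≥0 → Ω → ℝ) (H : List (ElemStep 𝓕 t)) (ω : Ω) : ℝ :=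
  (H.map fun s => s.coef ω * (B s.right ω - B s.left ω)).sum

/-- `I` is a version of the Itô integral `∫_t^∞ φ dB`: the `L²(μ)`-limit of the integrals of some
simple processes that converge to `φ` in `L²(μ ⊗ dr)` on `(t, ∞)`. -/
def IsItoIntegral {Ω : Type*} {m0 : MeasurableSpace Ω} (μ : Measure Ω) (𝓕 : Filtration ℝ≥0 m0)
    (B : ℝ≥0 → Ω → ℝ) (t : ℝ≥0) (φ : ℝ≥0 → Ω → ℝ) (I : Ω → ℝ) : Prop :=
  Measurable I ∧ ∃ H : ℕ → List (ElemStep 𝓕 t),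
    Tendsto (fun n => ∫⁻ ω, (∫⁻ r in Ioi (t : ℝ),
      ‖φ r.toNNReal ω - simpleValue (H n) r.toNNReal ω‖ₑ ^ 2) ∂μ) atTop (𝓝 0) ∧
    Tendsto (fun n => ∫⁻ ω, ‖I ω - simpleIntegral B (H n) ω‖ₑ ^ 2 ∂μ) atTop (𝓝 0)

/-! ### The market -/

/-- The incomplete market: a two-dimensional Brownian motion `W = (W 0, W 1)`, and a stock with
drift `drift` and volatility `vol` driven by `W 0`, whose market price of risk is bounded. -/
structure Market {Ω : Type*} {m0 : MeasurableSpace Ω} (μ : Measure Ω) [μ.IsComplete] where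
  W : Fin 2 → ℝ≥0 → Ω → ℝ
  measurable_W : ∀ i s, Measurable (W i s)
  isBrownian_W : ∀ i, IsBrownianReal (W i) μ
  indep_W : IndepFun (fun ω s => W 0 s ω) (fun ω s => W 1 s ω) μ
  drift : ℝ≥0 → Ω → ℝ
  vol : ℝ≥0 → Ω → ℝ
  progressive_drift : IsProgressive (brownianFiltration μ W measurable_W) drift
  progressive_vol : IsProgressive (brownianFiltration μ W measurable_W) vol
  vol_pos : ∀ s ω, 0 < vol s ω
  bounded_risk : ∃ C : ℝ, ∀ s ω, |drift s ω / vol s ω| ≤ C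

namespace Market

variable {Ω : Type*} {m0 : MeasurableSpace Ω} {μ : Measure Ω} [μ.IsComplete]

/-- The augmented Brownian filtration of the market. -/
def 𝓕 (M : Market μ) : Filtration ℝ≥0 m0 := brownianFiltration μ M.W M.measurable_W

/-- The market price of risk. -/
def θ (M : Market μ) (s : ℝ≥0) (ω : Ω) : ℝ := M.drift s ω / M.vol s ω

/-- The admissible strategies on `[t, τ]`: progressive processes with
`E[∫_σ^τ |π_r|² dr | 𝓕_σ] ≤ C` for some constant `C` and all stopping times `σ` valued in
`[t, τ]`. A strategy on `[t, τ]` is represented by a process on `[0, ∞)`; its values outside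
`(t, τ]` play no role. -/
def Admissible (M : Market μ) (t : ℝ≥0) (τ : Ω → ℝ≥0) (π : ℝ≥0 → Ω → ℝ) : Prop :=
  IsProgressive M.𝓕 π ∧
  ∃ C : ℝ, 0 < C ∧ ∀ (σ : Ω → ℝ≥0) (hσ : IsStoppingTime M.𝓕 (fun ω => (σ ω : WithTop ℝ≥0))),
    (∀ ω, t ≤ σ ω ∧ σ ω ≤ τ ω) →
    ∀ᵐ ω ∂μ, condLExp hσ.measurableSpace μ
      (fun ω' => ∫⁻ r in Ioc (σ ω' : ℝ) (τ ω'), ‖π r.toNNReal ω'‖ₑ ^ 2) ω ≤ ENNReal.ofReal C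

/-- `G` is a version of the gain `∫_t^τ π_r (θ_r dr + dW¹_r)`. -/
def IsGain (M : Market μ) (t : ℝ≥0) (τ : Ω → ℝ≥0) (π : ℝ≥0 → Ω → ℝ) (G : Ω → ℝ) : Prop :=
  ∃ I : Ω → ℝ,
    IsItoIntegral μ M.𝓕 (M.W 0) t (fun r ω => (Iic (τ ω)).indicator (fun s => π s ω) r) I ∧
    ∀ᵐ ω ∂μ, G ω = (∫ r in Ioc (t : ℝ) (τ ω), π r.toNNReal ω * M.θ r.toNNReal ω) + I ω

/-- The space `⋂_{p ≥ 1} L^p(𝓕_t)`, `p` finite. -/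
def LpAll (M : Market μ) (t : ℝ≥0) : Set (Ω → ℝ) :=
  {ξ | Measurable[M.𝓕 t] ξ ∧ ∀ p : ℝ≥0, 1 ≤ p → MemLp ξ p μ}

/-- The space `L^∞(𝓕_t)`. -/
def LInfty (M : Market μ) (t : ℝ≥0) : Set (Ω → ℝ) :=
  {X | Measurable[M.𝓕 t] X ∧ ∃ C : ℝ, ∀ᵐ ω ∂μ, |X ω| ≤ C}

/-- The deflators at time `t`: positive `𝓕_t`-measurable random variables with mean one. -/
def Deflators (M : Market μ) (t : ℝ≥0) : Set (Ω → ℝ) :=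
  {η | Measurable[M.𝓕 t] η ∧ (∀ᵐ ω ∂μ, 0 < η ω) ∧ Integrable η μ ∧ ∫ ω, η ω ∂μ = 1}

variable [IsFiniteMeasure μ]

/-- The value
`esssup_{π ∈ A_[t,τ]} E[U(τ, ξ + ∫_t^τ π_r (θ_r dr + dW¹_r) + P) | 𝓕_t]`
of optimal investment on `[t, τ]` from wealth `ξ` with endowment `P`. The random field `U` is
written `U s x ω`. -/
def primalValue (M : Market μ) (U : ℝ≥0 → ℝ → Ω → ℝ) (t : ℝ≥0) (τ : Ω → ℝ≥0) (P ξ : Ω → ℝ) :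
    Ω → EReal :=
  essSupFamily μ (M.𝓕.le t)
    {Y | ∃ (π : ℝ≥0 → Ω → ℝ) (G : Ω → ℝ), M.Admissible t τ π ∧ M.IsGain t τ π G ∧
      Y = genCondExp μ (M.𝓕 t) (fun ω => U (τ ω) (ξ ω + G ω + P ω) ω)}

/-- Forward performance processes. -/
structure IsForwardPerformance (M : Market μ) (U : ℝ≥0 → ℝ → Ω → ℝ) : Prop where
  progressive : ∀ x, IsProgressive M.𝓕 (fun s ω => U s x ω)
  strictMono : ∀ s, ∀ᵐ ω ∂μ, StrictMono fun x => U s x ω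
  strictConcave : ∀ s, ∀ᵐ ω ∂μ, StrictConcaveOn ℝ univ fun x => U s x ω
  selfGeneration : ∀ (τ : Ω → ℝ≥0), IsStoppingTime M.𝓕 (fun ω => (τ ω : WithTop ℝ≥0)) →
    (∃ N : ℝ≥0, ∀ ω, τ ω ≤ N) → ∀ t : ℝ≥0, (∀ ω, t ≤ τ ω) → ∀ ξ ∈ M.LpAll t,
      (fun ω => ((U t (ξ ω) ω : ℝ) : EReal)) =ᵐ[μ] M.primalValue U t τ 0 ξ

/-- The forward optimized certainty equivalent
`F(t, P; η, T) = esssup_{ξ ∈ ⋂ L^p(𝓕_t)} (u^P(t, ξ; T) - ξ η)`. -/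
def forwardOCE (M : Market μ) (U : ℝ≥0 → ℝ → Ω → ℝ) (t T : ℝ≥0) (η P : Ω → ℝ) : Ω → EReal :=
  essSupFamily μ (M.𝓕.le t)
    {Y | ∃ ξ ∈ M.LpAll t,
      Y = fun ω => M.primalValue U t (fun _ => T) P ξ ω - ((ξ ω * η ω : ℝ) : EReal)}

/-- The normalized forward OCE `F(t, P; η, T) - F(t, 0; η, T)`. -/
def normForwardOCE (M : Market μ) (U : ℝ≥0 → ℝ → Ω → ℝ) (t T : ℝ≥0) (η P : Ω → ℝ) :
    Ω → EReal :=
  fun ω => M.forwardOCE U t T η P ω - M.forwardOCE U t T η 0 ω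

end Market

end

end ForwardOCE

/-!
The forward optimized certainty equivalent is an iterated essential supremum, over initial wealth
`ξ` and over strategies `π`, of generalized conditional expectations of `U(T, ξ + G + P)`, where `G`
is the gain of `π`. Each property comes from an operation on this pair of families.

* Monotonicity is that of `U(T, ·)`, passed through `genCondExp_mono` and `IsEssSup.mono`.
* Cash `c` added to `P` is a shift of `ξ` by `c`, which costs `-η c` in the penalty `ξ η`.
* A gain added to `P` is a shift of the strategy, since admissible strategies and their gains are
  stable under addition and subtraction (`Admissible.combine`, `IsGain.combine`).
* For concavity the weight is known at time `t`, so wealth, strategies and gains may be mixed with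
  it: the weight is absorbed by the coefficients of the simple integrands in the definition of the
  Itô integral (`IsItoIntegral.combine`). Concavity of `U(T, ·)`, the pull-out property and the
  superadditivity of the generalized conditional expectation give the inequality for members of
  the families, and `IsEssSup.mul_add_mul_le` carries it to the essential suprema, with infinite
  values allowed.
* The normalized version makes sense because `F(t, 0; η, T)` is finite. By self-generation it is
  the essential supremum of `U(t, ξ) - ξ η`, hence at most the supremum of `x ↦ U(t, x) - x η`. The
  upper bound on the risk tolerance makes the marginal utility decay at least like `exp (-x / C)`
  as wealth grows and blow up at least at that rate as wealth falls, so this supremum is finite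
  (`exists_forall_sub_mul_le`).
-/

namespace ForwardOCE

/-! ### Essential suprema -/

section EssSup

variable {Ω : Type*} {m0 : MeasurableSpace Ω} {μ : Measure Ω} {m : MeasurableSpace Ω}

/-- An inequality `a f + W ≤ Z` holding along a family passes to its essential supremum, whatever
infinite values occur. The inequality is solved for `f`, which yields an upper bound of the family;
solving fails only for `W = Z = ±∞`, where the inequality is void and the bound is set to `∞`. -/
theorem IsEssSup.mul_add_le {S : Set (Ω → EReal)} {Y W Z : Ω → EReal} {a : Ω → ℝ}
    (hY : IsEssSup μ m S Y) (ha : Measurable[m] a) (ha0 : ∀ ω, 0 < a ω) (hW : Measurable[m] W)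
    (hZ : Measurable[m] Z) (h : ∀ f ∈ S, ∀ᵐ ω ∂μ, (a ω : EReal) * f ω + W ω ≤ Z ω) :
    ∀ᵐ ω ∂μ, (a ω : EReal) * Y ω + W ω ≤ Z ω := by
  classical
  let D : Set Ω := {ω | (W ω = ⊥ ∧ Z ω = ⊥) ∨ (W ω = ⊤ ∧ Z ω = ⊤)}
  have hD : MeasurableSet[m] D :=
    ((hW (measurableSet_singleton ⊥)).inter (hZ (measurableSet_singleton ⊥))).union
      ((hW (measurableSet_singleton ⊤)).inter (hZ (measurableSet_singleton ⊤)))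
  let V : Ω → EReal := fun ω => if ω ∈ D then ⊤ else (Z ω + -W ω) * (((a ω)⁻¹ : ℝ) : EReal)
  have hV : Measurable[m] V :=
    Measurable.ite hD measurable_const
      ((hZ.add hW.neg).mul ha.inv.coe_real_ereal)
  have key : ∀ ω, ∀ y : EReal, (a ω : EReal) * y + W ω ≤ Z ω ↔ y ≤ V ω := by
    intro ω y
    by_cases hω : ω ∈ D
    · simp only [V, if_pos hω, le_top, iff_true]
      rcases hω with ⟨h1, h2⟩ | ⟨h1, h2⟩ <;> simp [h1, h2]
    · have h1 : W ω ≠ ⊥ ∨ Z ω ≠ ⊥ := by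
        by_contra! hc; exact hω (Or.inl hc)
      have h2 : W ω ≠ ⊤ ∨ Z ω ≠ ⊤ := by
        by_contra! hc; exact hω (Or.inr hc)
      simp only [V, if_neg hω]
      rw [← EReal.le_sub_iff_add_le h1 h2, EReal.coe_inv, mul_comm (_ + _), ← EReal.div_eq_inv_mul,
        EReal.le_div_iff_mul_le (by exact_mod_cast ha0 ω) (EReal.coe_ne_top _), mul_comm,
        sub_eq_add_neg]
  have := hY.least V hV fun f hf => by
    filter_upwards [h f hf] with ω hω using (key ω _).1 hω
  filter_upwards [this] with ω hω using (key ω _).2 hω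

/-- A bound on `a f + b g` for all members of two families bounds the corresponding combination of
their essential suprema. -/
theorem IsEssSup.mul_add_mul_le {S₁ S₂ : Set (Ω → EReal)} {Y₁ Y₂ Z : Ω → EReal} {a b : Ω → ℝ}
    (h₁ : IsEssSup μ m S₁ Y₁) (h₂ : IsEssSup μ m S₂ Y₂) (hS₂ : ∀ g ∈ S₂, Measurable[m] g)
    (ha : Measurable[m] a) (ha0 : ∀ ω, 0 < a ω) (hb : Measurable[m] b) (hb0 : ∀ ω, 0 < b ω)
    (hZ : Measurable[m] Z)
    (h : ∀ f ∈ S₁, ∀ g ∈ S₂, ∀ᵐ ω ∂μ, (a ω : EReal) * f ω + (b ω : EReal) * g ω ≤ Z ω) :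
    ∀ᵐ ω ∂μ, (a ω : EReal) * Y₁ ω + (b ω : EReal) * Y₂ ω ≤ Z ω := by
  simp_rw [add_comm ((a _ : EReal) * Y₁ _)]
  refine h₂.mul_add_le hb hb0 (ha.coe_real_ereal.mul h₁.measurable) hZ fun g hg => ?_
  simp_rw [add_comm ((b _ : EReal) * _)]
  exact h₁.mul_add_le ha ha0 (hb.coe_real_ereal.mul (hS₂ g hg)) hZ fun f hf => h f hf g hg

/-- The essential supremum is monotone for domination of families. -/
theorem IsEssSup.mono {S₁ S₂ : Set (Ω → EReal)} {Y₁ Y₂ : Ω → EReal}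
    (h₁ : IsEssSup μ m S₁ Y₁) (h₂ : IsEssSup μ m S₂ Y₂)
    (h : ∀ f ∈ S₁, ∃ g ∈ S₂, f ≤ᵐ[μ] g) : Y₁ ≤ᵐ[μ] Y₂ :=
  h₁.least _ h₂.measurable fun f hf =>
    let ⟨g, hg, hfg⟩ := h f hf
    hfg.trans (h₂.le g hg)

end EssSup

/-! ### Generalized conditional expectations -/

section GenCondExp

variable {Ω : Type*} {m0 : MeasurableSpace Ω} {μ : Measure Ω} {m : MeasurableSpace Ω}

theorem measurable_genCondExp (X : Ω → ℝ) : Measurable[m] (genCondExp μ m X) := by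
  unfold genCondExp
  simp_rw [sub_eq_add_neg]
  exact (measurable_condLExp _ _ _).coe_ereal_ennreal.add
    (measurable_condLExp _ _ _).coe_ereal_ennreal.neg

theorem genCondExp_mono {X Y : Ω → ℝ} (h : X ≤ᵐ[μ] Y) :
    genCondExp μ m X ≤ᵐ[μ] genCondExp μ m Y := by
  have h1 : condLExp m μ (fun ω => ENNReal.ofReal (X ω)) ≤ᵐ[μ]
      condLExp m μ (fun ω => ENNReal.ofReal (Y ω)) :=
    condLExp_mono (h.mono fun ω hω => ENNReal.ofReal_le_ofReal hω)
  have h2 : condLExp m μ (fun ω => ENNReal.ofReal (-Y ω)) ≤ᵐ[μ]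
      condLExp m μ (fun ω => ENNReal.ofReal (-X ω)) :=
    condLExp_mono (h.mono fun ω hω => ENNReal.ofReal_le_ofReal (neg_le_neg hω))
  filter_upwards [h1, h2] with ω h1 h2
  exact EReal.sub_le_sub (EReal.coe_ennreal_le_coe_ennreal_iff.2 h1)
    (EReal.coe_ennreal_le_coe_ennreal_iff.2 h2)

/-- Pull-out property of the conditional Lebesgue expectation. -/
theorem condLExp_mul_left [IsFiniteMeasure μ] (hm : m ≤ m0) {A X : Ω → ℝ≥0∞}
    (hA : Measurable[m] A) (hX : AEMeasurable X μ) :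
    condLExp m μ (fun ω => A ω * X ω) =ᵐ[μ] fun ω => A ω * condLExp m μ X ω := by
  refine (ae_eq_condLExp hm _ _ (hA.mul (measurable_condLExp _ _ _)) fun s hs => ?_).symm
  have htrim : (μ.withDensity X).trim hm = (μ.withDensity (condLExp m μ X)).trim hm := by
    ext u hu
    rw [trim_measurableSet_eq hm hu, trim_measurableSet_eq hm hu, withDensity_apply _ (hm u hu),
      withDensity_apply _ (hm u hu), setLIntegral_condLExp hm _ _ hu]
  have aux : ∀ Y : Ω → ℝ≥0∞, AEMeasurable Y μ →
      ∫⁻ ω in s, A ω * Y ω ∂μ = ∫⁻ ω in s, A ω ∂((μ.withDensity Y).trim hm) := by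
    intro Y hY
    rw [setLIntegral_trim hm hA hs, restrict_withDensity (hm s hs),
      lintegral_withDensity_eq_lintegral_mul₀ hY.restrict (hA.mono hm le_rfl).aemeasurable]
    simp_rw [Pi.mul_apply, mul_comm]
  rw [aux X hX, htrim]
  exact aux _ (measurable_condLExp' _ _ _).aemeasurable

theorem genCondExp_mul [IsFiniteMeasure μ] (hm : m ≤ m0) {a X : Ω → ℝ}
    (ha : Measurable[m] a) (ha0 : ∀ ω, 0 ≤ a ω) (hX : AEMeasurable X μ) :
    genCondExp μ m (fun ω => a ω * X ω) =ᵐ[μ] fun ω => (a ω : EReal) * genCondExp μ m X ω := by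
  have h1 := condLExp_mul_left hm ha.ennreal_ofReal hX.ennreal_ofReal
  have h2 := condLExp_mul_left hm ha.ennreal_ofReal hX.neg.ennreal_ofReal
  filter_upwards [h1, h2] with ω h1 h2
  simp only [genCondExp, ← mul_neg, ENNReal.ofReal_mul (ha0 _)]
  simp only [Pi.neg_apply] at h2
  rw [h1, h2, EReal.coe_ennreal_mul, EReal.coe_ennreal_mul, EReal.coe_ennreal_ofReal,
    max_eq_left (ha0 ω), EReal.mul_sub_of_nonneg_of_ne_top (by exact_mod_cast ha0 ω)
    (EReal.coe_ne_top _)]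

theorem ereal_sub_add_sub_le {a₁ a₂ b₁ b₂ A B : ℝ≥0∞} (h : B + (a₁ + a₂) ≤ A + (b₁ + b₂))
    (hB : B ≤ b₁ + b₂) :
    ((a₁ : EReal) - b₁) + ((a₂ : EReal) - b₂) ≤ (A : EReal) - B := by
  rcases eq_or_ne b₁ ⊤ with rfl | hb₁
  · simp
  rcases eq_or_ne b₂ ⊤ with rfl | hb₂
  · simp
  have hBt : B ≠ ⊤ := ne_top_of_le_ne_top (by simp [hb₁, hb₂]) hB
  lift b₁ to ℝ≥0 using hb₁
  lift b₂ to ℝ≥0 using hb₂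
  lift B to ℝ≥0 using hBt
  rcases eq_or_ne A ⊤ with rfl | hA
  · have : ((⊤ : ℝ≥0∞) : EReal) - ((B : ℝ≥0∞) : EReal) = ⊤ := by
      exact EReal.top_sub_coe (B : ℝ)
    rw [this]; exact le_top
  have hfin : a₁ + a₂ ≠ ⊤ := by
    refine ne_top_of_le_ne_top ?_ (le_add_self.trans h)
    simp [hA]
  rw [ENNReal.add_ne_top] at hfin
  obtain ⟨h1, h2⟩ := hfin
  lift a₁ to ℝ≥0 using h1
  lift a₂ to ℝ≥0 using h2
  lift A to ℝ≥0 using hA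
  have h' : (B : ℝ) + (a₁ + a₂) ≤ A + (b₁ + b₂) := by exact_mod_cast h
  have : ((a₁ : ℝ) - b₁) + ((a₂ : ℝ) - b₂) ≤ (A : ℝ) - B := by linarith
  simp_rw [EReal.coe_nnreal_eq_coe_real]
  exact_mod_cast this

/-- With the convention `∞ - ∞ = -∞`, the generalized conditional expectation is superadditive. -/
theorem genCondExp_add_le {X Y : Ω → ℝ} (hX : AEMeasurable X μ) (hY : AEMeasurable Y μ) :
    ∀ᵐ ω ∂μ, genCondExp μ m X ω + genCondExp μ m Y ω ≤ genCondExp μ m (fun ω => X ω + Y ω) ω := by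
  have hid : ∀ x y : ℝ, ENNReal.ofReal (-(x + y)) + (ENNReal.ofReal x + ENNReal.ofReal y)
      = ENNReal.ofReal (x + y) + (ENNReal.ofReal (-x) + ENNReal.ofReal (-y)) := by
    intro x y
    have h1 : ∀ z : ℝ, ENNReal.ofReal z = ENNReal.ofReal (max z 0) := fun z => by
      rcases le_total 0 z with hz | hz <;> simp [hz]
    have h2 : ∀ z : ℝ, max z 0 - max (-z) 0 = z := fun z => by
      rcases le_total 0 z with hz | hz <;> simp [hz]
    rw [h1 x, h1 y, h1 (x + y), h1 (-x), h1 (-y), h1 (-(x + y)),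
      ← ENNReal.ofReal_add, ← ENNReal.ofReal_add, ← ENNReal.ofReal_add, ← ENNReal.ofReal_add]
    · congr 1
      linarith [h2 x, h2 y, h2 (x + y)]
    all_goals positivity
  let p : (Ω → ℝ) → Ω → ℝ≥0∞ := fun Z ω => ENNReal.ofReal (Z ω)
  have hp : ∀ Z, AEMeasurable Z μ → AEMeasurable (p Z) μ := fun Z hZ => hZ.ennreal_ofReal
  have e : p (-(X + Y)) + (p X + p Y) = p (X + Y) + (p (-X) + p (-Y)) :=
    funext fun ω => hid (X ω) (Y ω)
  have c1 := condLExp_add_left (mΩ := m) (p X + p Y) (hp _ (hX.add hY).neg)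
  have c2 := condLExp_add_left (mΩ := m) (p (-X) + p (-Y)) (hp _ (hX.add hY))
  have c3 := condLExp_add_left (mΩ := m) (p Y) (hp _ hX)
  have c4 := condLExp_add_left (mΩ := m) (p (-Y)) (hp _ hX.neg)
  have c5 : condLExp m μ (p (-(X + Y))) ≤ᵐ[μ] condLExp m μ (p (-X) + p (-Y)) := by
    refine condLExp_mono (Eventually.of_forall fun ω => ?_)
    simp only [p, Pi.neg_apply, Pi.add_apply, neg_add]
    exact ENNReal.ofReal_add_le
  filter_upwards [c1, c2, c3, c4, c5] with ω c1 c2 c3 c4 c5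
  rw [e] at c1
  rw [c1] at c2
  simp only [Pi.add_apply] at c2 c3 c4
  rw [c3, c4] at c2
  rw [c4] at c5
  exact ereal_sub_add_sub_le c2.le c5

end GenCondExp

/-! ### Progressive processes and the Itô integral -/

section Ito

variable {Ω : Type*} {m0 : MeasurableSpace Ω} {μ : Measure Ω} {𝓕 : Filtration ℝ≥0 m0} {t : ℝ≥0}

theorem enorm_mul_add_mul_sq_le {a b K : ℝ} (ha : |a| ≤ K) (hb : |b| ≤ K) (x y : ℝ) :
    ‖a * x + b * y‖ₑ ^ 2 ≤
      ENNReal.ofReal (2 * K ^ 2) * ‖x‖ₑ ^ 2 + ENNReal.ofReal (2 * K ^ 2) * ‖y‖ₑ ^ 2 := by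
  have e : ∀ z : ℝ, ‖z‖ₑ ^ 2 = ENNReal.ofReal (z ^ 2) := fun z => by
    rw [← ofReal_norm, ← ENNReal.ofReal_pow (norm_nonneg _), Real.norm_eq_abs, sq_abs]
  rw [e, e, e, ← ENNReal.ofReal_mul (by positivity), ← ENNReal.ofReal_mul (by positivity),
    ← ENNReal.ofReal_add (by positivity) (by positivity)]
  refine ENNReal.ofReal_le_ofReal ?_
  have ha2 : a ^ 2 ≤ K ^ 2 := sq_le_sq.2 (ha.trans (le_abs_self K))
  have hb2 : b ^ 2 ≤ K ^ 2 := sq_le_sq.2 (hb.trans (le_abs_self K))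
  nlinarith [sq_nonneg (a * x - b * y), mul_le_mul_of_nonneg_right ha2 (sq_nonneg x),
    mul_le_mul_of_nonneg_right hb2 (sq_nonneg y)]

/-- A progressive process is jointly measurable. -/
theorem measurable_uncurry_of_isProgressive {u : ℝ≥0 → Ω → ℝ} (hu : IsProgressive 𝓕 u) :
    Measurable (Function.uncurry u) := by
  have h : ∀ n : ℕ, Measurable fun p : ℝ≥0 × Ω => u (min p.1 n) p.2 := by
    intro n
    have h1 : Measurable fun p : Iic (n : ℝ≥0) × Ω => u p.1 p.2 :=
      (hu n).mono (sup_le_sup le_rfl (MeasurableSpace.comap_mono (𝓕.le n))) le_rfl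
    have h2 : Measurable fun p : ℝ≥0 × Ω =>
        ((⟨min p.1 n, mem_Iic.2 (min_le_right _ _)⟩ : Iic (n : ℝ≥0)), p.2) :=
      ((measurable_fst.min measurable_const).subtype_mk).prodMk measurable_snd
    exact h1.comp h2
  refine measurable_of_tendsto_metrizable h (tendsto_pi_nhds.2 fun p => ?_)
  obtain ⟨N, hN⟩ := exists_nat_ge p.1
  refine tendsto_const_nhds.congr' ?_
  filter_upwards [eventually_ge_atTop N] with n hn
  have : p.1 ≤ n := hN.trans (by exact_mod_cast hn)
  simp [Function.uncurry, min_eq_left this]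

/-- A random variable known at time `t`, switched on after `t`, is a progressive process. -/
theorem isProgressive_ite_lt {a : Ω → ℝ} (ha : Measurable[𝓕 t] a) :
    IsProgressive 𝓕 fun r ω => if t < r then a ω else 0 := by
  intro i
  rcases le_or_gt i t with hi | hi
  · have : (fun p : Iic i × Ω => if t < (p.1 : ℝ≥0) then a p.2 else 0) = fun _ => 0 := by
      funext p
      exact if_neg (not_lt.2 ((mem_Iic.1 p.1.2).trans hi))
    rw [this]
    exact measurable_const
  · let : MeasurableSpace Ω := 𝓕 i
    have ha' : Measurable a := ha.mono (𝓕.mono hi.le) le_rfl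
    exact Measurable.ite
      (measurableSet_lt measurable_const (measurable_subtype_coe.comp measurable_fst))
      (ha'.comp measurable_snd) measurable_const

/-- The process `a φ + b ψ` on `(t, ∞)`, and zero up to time `t`. -/
noncomputable def combineAfter (t : ℝ≥0) (a b : Ω → ℝ) (φ ψ : ℝ≥0 → Ω → ℝ) (r : ℝ≥0) (ω : Ω) :
    ℝ :=
  (if t < r then a ω else 0) * φ r ω + (if t < r then b ω else 0) * ψ r ω

theorem combineAfter_of_lt {a b : Ω → ℝ} {φ ψ : ℝ≥0 → Ω → ℝ} {r : ℝ≥0} (h : t < r) (ω : Ω) :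
    combineAfter t a b φ ψ r ω = a ω * φ r ω + b ω * ψ r ω := by
  simp [combineAfter, h]

theorem isProgressive_combineAfter {a b : Ω → ℝ} {φ ψ : ℝ≥0 → Ω → ℝ} (ha : Measurable[𝓕 t] a)
    (hb : Measurable[𝓕 t] b) (hφ : IsProgressive 𝓕 φ) (hψ : IsProgressive 𝓕 ψ) :
    IsProgressive 𝓕 (combineAfter t a b φ ψ) :=
  ((isProgressive_ite_lt ha).mul hφ).add ((isProgressive_ite_lt hb).mul hψ)

/-- Multiplication of an elementary step by a bounded random variable known at time `t`. -/
def ElemStep.scale (s : ElemStep 𝓕 t) (a : Ω → ℝ) (ha : Measurable[𝓕 t] a)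
    (ha' : ∃ K : ℝ, ∀ ω, |a ω| ≤ K) : ElemStep 𝓕 t where
  left := s.left
  right := s.right
  le_left := s.le_left
  left_le_right := s.left_le_right
  coef := fun ω => a ω * s.coef ω
  measurable_coef := (ha.mono (𝓕.mono s.le_left) le_rfl).mul s.measurable_coef
  bounded_coef := by
    obtain ⟨K, hK⟩ := ha'
    obtain ⟨C, hC⟩ := s.bounded_coef
    refine ⟨K * C, fun ω => ?_⟩
    rw [abs_mul]
    exact mul_le_mul (hK ω) (hC ω) (abs_nonneg _) ((abs_nonneg _).trans (hK ω))

theorem simpleValue_scale_append (H₁ H₂ : List (ElemStep 𝓕 t)) {a b : Ω → ℝ}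
    (ha : Measurable[𝓕 t] a) (ha' : ∃ K : ℝ, ∀ ω, |a ω| ≤ K) (hb : Measurable[𝓕 t] b)
    (hb' : ∃ K : ℝ, ∀ ω, |b ω| ≤ K) (r : ℝ≥0) (ω : Ω) :
    simpleValue (H₁.map (fun s => s.scale a ha ha') ++ H₂.map fun s => s.scale b hb hb') r ω
      = a ω * simpleValue H₁ r ω + b ω * simpleValue H₂ r ω := by
  simp only [simpleValue, List.map_append, List.sum_append, List.map_map, ← List.sum_map_mul_left]
  congr 3 <;> funext s <;> by_cases h : r ∈ Ioc s.left s.right <;>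
    simp [ElemStep.scale, h]

theorem simpleIntegral_scale_append (B : ℝ≥0 → Ω → ℝ) (H₁ H₂ : List (ElemStep 𝓕 t)) {a b : Ω → ℝ}
    (ha : Measurable[𝓕 t] a) (ha' : ∃ K : ℝ, ∀ ω, |a ω| ≤ K) (hb : Measurable[𝓕 t] b)
    (hb' : ∃ K : ℝ, ∀ ω, |b ω| ≤ K) (ω : Ω) :
    simpleIntegral B (H₁.map (fun s => s.scale a ha ha') ++ H₂.map fun s => s.scale b hb hb') ω
      = a ω * simpleIntegral B H₁ ω + b ω * simpleIntegral B H₂ ω := by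
  simp only [simpleIntegral, List.map_append, List.sum_append, List.map_map,
    ← List.sum_map_mul_left]
  congr 3 <;> funext s <;> simp [ElemStep.scale, mul_assoc]

theorem measurable_simpleValue (H : List (ElemStep 𝓕 t)) :
    Measurable fun p : ℝ≥0 × Ω => simpleValue H p.1 p.2 := by
  unfold simpleValue
  induction H with
  | nil => simp
  | cons s H ih =>
    simp only [List.map_cons, List.sum_cons]
    refine Measurable.add ?_ ih
    have : (fun p : ℝ≥0 × Ω => (Ioc s.left s.right).indicator (fun _ => s.coef p.2) p.1)
        = (Prod.fst ⁻¹' Ioc s.left s.right).indicator fun p => s.coef p.2 := rfl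
    rw [this]
    exact ((s.measurable_coef.mono (𝓕.le _) le_rfl).comp measurable_snd).indicator
      (measurable_fst measurableSet_Ioc)

theorem measurable_simpleIntegral {B : ℝ≥0 → Ω → ℝ} (hB : ∀ s, Measurable (B s))
    (H : List (ElemStep 𝓕 t)) : Measurable (simpleIntegral B H) := by
  unfold simpleIntegral
  induction H with
  | nil => simp
  | cons s H ih =>
    simp only [List.map_cons, List.sum_cons]
    exact ((s.measurable_coef.mono (𝓕.le _) le_rfl).mul ((hB _).sub (hB _))).add ih

/-- The Itô integral on `(t, ∞)` is linear over bounded random variables known at time `t`. Such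
variables may be pulled into the coefficients of simple integrands living after `t`. -/
theorem IsItoIntegral.combine {B : ℝ≥0 → Ω → ℝ} (hB : ∀ s, Measurable (B s))
    {φ ψ χ : ℝ≥0 → Ω → ℝ} {I J : Ω → ℝ} (hI : IsItoIntegral μ 𝓕 B t φ I)
    (hJ : IsItoIntegral μ 𝓕 B t ψ J) (hφ : Measurable (Function.uncurry φ))
    (hψ : Measurable (Function.uncurry ψ)) {a b : Ω → ℝ} (ha : Measurable[𝓕 t] a)
    (hb : Measurable[𝓕 t] b) {K : ℝ} (haK : ∀ ω, |a ω| ≤ K) (hbK : ∀ ω, |b ω| ≤ K)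
    (hχ : ∀ r ω, t < r → χ r ω = a ω * φ r ω + b ω * ψ r ω) :
    IsItoIntegral μ 𝓕 B t χ fun ω => a ω * I ω + b ω * J ω := by
  obtain ⟨hIm, H₁, h₁, h₁'⟩ := hI
  obtain ⟨hJm, H₂, h₂, h₂'⟩ := hJ
  have lim : ∀ {u v : ℕ → ℝ≥0∞}, Tendsto u atTop (𝓝 0) → Tendsto v atTop (𝓝 0) →
      Tendsto (fun n => ENNReal.ofReal (2 * K ^ 2) * u n + ENNReal.ofReal (2 * K ^ 2) * v n)
        atTop (𝓝 0) := by
    intro u v hu hv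
    have h := (ENNReal.Tendsto.const_mul (a := ENNReal.ofReal (2 * K ^ 2)) hu
      (Or.inr ENNReal.ofReal_ne_top)).add (ENNReal.Tendsto.const_mul
      (a := ENNReal.ofReal (2 * K ^ 2)) hv (Or.inr ENNReal.ofReal_ne_top))
    rwa [mul_zero, add_zero] at h
  refine ⟨((ha.mono (𝓕.le t) le_rfl).mul hIm).add ((hb.mono (𝓕.le t) le_rfl).mul hJm),
    fun n => (H₁ n).map (fun s => s.scale a ha ⟨K, haK⟩) ++
      (H₂ n).map fun s => s.scale b hb ⟨K, hbK⟩, ?_, ?_⟩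
  · have hm : ∀ {ζ : ℝ≥0 → Ω → ℝ}, Measurable (Function.uncurry ζ) → ∀ H : List (ElemStep 𝓕 t),
        Measurable fun p : Ω × ℝ => ‖ζ p.2.toNNReal p.1 - simpleValue H p.2.toNNReal p.1‖ₑ ^ 2 := by
      intro ζ hζ H
      have hs : Measurable fun p : Ω × ℝ => (p.2.toNNReal, p.1) :=
        (measurable_real_toNNReal.comp measurable_snd).prodMk measurable_fst
      exact (((hζ.comp hs).sub ((measurable_simpleValue H).comp hs)).enorm).pow_const 2
    refine tendsto_of_tendsto_of_tendsto_of_le_of_le tendsto_const_nhds (lim h₁ h₂)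
      (fun n => zero_le) fun n => ?_
    have m₁ := hm hφ (H₁ n)
    have m₂ := hm hψ (H₂ n)
    rw [← lintegral_const_mul _ m₁.lintegral_prod_right',
      ← lintegral_const_mul _ m₂.lintegral_prod_right',
      ← lintegral_add_left (m₁.lintegral_prod_right'.const_mul _)]
    refine lintegral_mono fun ω => ?_
    have m₁ω := m₁.comp (measurable_prodMk_left (x := ω))
    have m₂ω := m₂.comp (measurable_prodMk_left (x := ω))
    simp only [Function.comp_def] at m₁ω m₂ω
    simp only
    rw [← lintegral_const_mul _ m₁ω, ← lintegral_const_mul _ m₂ω,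
      ← lintegral_add_left (m₁ω.const_mul _)]
    refine setLIntegral_mono' measurableSet_Ioi fun r hr => ?_
    have hr' : t < r.toNNReal := by
      rw [Real.lt_toNNReal_iff_coe_lt]; exact hr
    rw [simpleValue_scale_append, hχ _ _ hr']
    convert enorm_mul_add_mul_sq_le (haK ω) (hbK ω)
      (φ r.toNNReal ω - simpleValue (H₁ n) r.toNNReal ω)
      (ψ r.toNNReal ω - simpleValue (H₂ n) r.toNNReal ω) using 3
    ring
  · refine tendsto_of_tendsto_of_tendsto_of_le_of_le tendsto_const_nhds (lim h₁' h₂')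
      (fun n => zero_le) fun n => ?_
    have m₁ := ((hIm.sub (measurable_simpleIntegral hB (H₁ n))).enorm).pow_const 2
    have m₂ := ((hJm.sub (measurable_simpleIntegral hB (H₂ n))).enorm).pow_const 2
    simp only [Pi.sub_apply] at m₁ m₂
    rw [← lintegral_const_mul _ m₁, ← lintegral_const_mul _ m₂,
      ← lintegral_add_left (m₁.const_mul _)]
    refine lintegral_mono fun ω => ?_
    rw [simpleIntegral_scale_append]
    convert enorm_mul_add_mul_sq_le (haK ω) (hbK ω) (I ω - simpleIntegral B (H₁ n) ω)
      (J ω - simpleIntegral B (H₂ n) ω) using 3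
    ring

end Ito

/-! ### Admissible strategies and their gains -/

namespace Market

section Gains

variable {Ω : Type*} {m0 : MeasurableSpace Ω} {μ : Measure Ω} [μ.IsComplete] {M : Market μ}
  {t T : ℝ≥0}

theorem measurable_uncurry_θ (M : Market μ) : Measurable (Function.uncurry M.θ) :=
  (measurable_uncurry_of_isProgressive M.progressive_drift).div
    (measurable_uncurry_of_isProgressive M.progressive_vol)

theorem measurable_uncurry_comp_toNNReal {u : ℝ≥0 → Ω → ℝ}
    (hu : Measurable (Function.uncurry u)) :
    Measurable fun p : Ω × ℝ => u p.2.toNNReal p.1 :=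
  hu.comp ((measurable_real_toNNReal.comp measurable_snd).prodMk measurable_fst)

theorem measurable_setLIntegral_enorm_sq {u : ℝ≥0 → Ω → ℝ} (hu : Measurable (Function.uncurry u))
    {σ : Ω → ℝ≥0} (hσ : Measurable σ) (T : ℝ≥0) :
    Measurable fun ω => ∫⁻ r in Ioc (σ ω : ℝ) T, ‖u r.toNNReal ω‖ₑ ^ 2 := by
  have hS : MeasurableSet {p : Ω × ℝ | (σ p.1 : ℝ) < p.2 ∧ p.2 ≤ T} :=
    (measurableSet_lt (hσ.comp measurable_fst).coe_nnreal_real measurable_snd).inter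
      (measurableSet_le measurable_snd measurable_const)
  have h := ((((measurable_uncurry_comp_toNNReal hu).enorm).pow_const 2).indicator
    hS).lintegral_prod_right' (ν := volume)
  convert h using 2 with ω
  rw [← lintegral_indicator measurableSet_Ioc]
  rfl

/-- A bounded combination of admissible strategies, with coefficients known at time `t`, is
admissible. -/
theorem Admissible.combine [IsFiniteMeasure μ] {π₁ π₂ : ℝ≥0 → Ω → ℝ}
    (h₁ : M.Admissible t (fun _ => T) π₁) (h₂ : M.Admissible t (fun _ => T) π₂) {a b : Ω → ℝ}
    (ha : Measurable[M.𝓕 t] a) (hb : Measurable[M.𝓕 t] b) {K : ℝ} (haK : ∀ ω, |a ω| ≤ K)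
    (hbK : ∀ ω, |b ω| ≤ K) : M.Admissible t (fun _ => T) (combineAfter t a b π₁ π₂) := by
  obtain ⟨hp₁, C₁, hC₁, hC₁'⟩ := h₁
  obtain ⟨hp₂, C₂, hC₂, hC₂'⟩ := h₂
  refine ⟨isProgressive_combineAfter ha hb hp₁ hp₂, 2 * K ^ 2 * (C₁ + C₂) + 1, by positivity,
    fun σ hσ hσt => ?_⟩
  have hσm : Measurable σ := by
    refine measurable_of_Iic fun i => ?_
    have := (M.𝓕.le i) _ (hσ.measurableSet_le i)
    simpa only [Set.preimage, mem_Iic, WithTop.coe_le_coe] using this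
  have hu₁ := measurable_uncurry_of_isProgressive hp₁
  have hu₂ := measurable_uncurry_of_isProgressive hp₂
  let X : (ℝ≥0 → Ω → ℝ) → Ω → ℝ≥0∞ := fun π ω =>
    ∫⁻ r in Ioc (σ ω : ℝ) T, ‖π r.toNNReal ω‖ₑ ^ 2
  have hX₁ : Measurable (X π₁) := measurable_setLIntegral_enorm_sq hu₁ hσm T
  have hX₂ : Measurable (X π₂) := measurable_setLIntegral_enorm_sq hu₂ hσm T
  have hle : X (combineAfter t a b π₁ π₂) ≤
      ENNReal.ofReal (2 * K ^ 2) • X π₁ + ENNReal.ofReal (2 * K ^ 2) • X π₂ := by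
    intro ω
    have m₁ := (((measurable_uncurry_comp_toNNReal hu₁).enorm).pow_const 2).comp
      (measurable_prodMk_left (x := ω))
    have m₂ := (((measurable_uncurry_comp_toNNReal hu₂).enorm).pow_const 2).comp
      (measurable_prodMk_left (x := ω))
    simp only [Function.comp_def] at m₁ m₂
    simp only [X, Pi.add_apply, Pi.smul_apply, smul_eq_mul]
    rw [← lintegral_const_mul _ m₁, ← lintegral_const_mul _ m₂,
      ← lintegral_add_left (m₁.const_mul _)]
    refine setLIntegral_mono' measurableSet_Ioc fun r hr => ?_
    have hr' : t < r.toNNReal :=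
      (hσt ω).1.trans_lt (by rw [Real.lt_toNNReal_iff_coe_lt]; exact hr.1)
    rw [combineAfter_of_lt hr']
    exact enorm_mul_add_mul_sq_le (haK ω) (hbK ω) _ _
  have e₀ := condLExp_mono (mΩ := hσ.measurableSpace) (P := μ) (Eventually.of_forall hle)
  have e₁ := condLExp_add_left (mΩ := hσ.measurableSpace) (P := μ)
    (ENNReal.ofReal (2 * K ^ 2) • X π₂) (hX₁.const_smul (ENNReal.ofReal (2 * K ^ 2))).aemeasurable
  have e₂ := condLExp_smul' (mΩ := hσ.measurableSpace) (P := μ) (X π₁)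
    (c := ENNReal.ofReal (2 * K ^ 2)) ENNReal.ofReal_ne_top
  have e₃ := condLExp_smul' (mΩ := hσ.measurableSpace) (P := μ) (X π₂)
    (c := ENNReal.ofReal (2 * K ^ 2)) ENNReal.ofReal_ne_top
  filter_upwards [e₀, e₁, e₂, e₃, hC₁' σ hσ hσt, hC₂' σ hσ hσt] with ω e₀ e₁ e₂ e₃ b₁ b₂
  refine e₀.trans ?_
  rw [e₁, Pi.add_apply, e₂, e₃]
  simp only [Pi.smul_apply, smul_eq_mul]
  refine (add_le_add (mul_le_mul_right b₁ _) (mul_le_mul_right b₂ _)).trans ?_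
  rw [← ENNReal.ofReal_mul (by positivity), ← ENNReal.ofReal_mul (by positivity),
    ← ENNReal.ofReal_add (by positivity) (by positivity)]
  exact ENNReal.ofReal_le_ofReal (by linarith)

/-- The drift part of the gain of an admissible strategy is a convergent integral. -/
theorem Admissible.integrableOn_mul_θ [IsFiniteMeasure μ] {π : ℝ≥0 → Ω → ℝ} (htT : t ≤ T)
    (h : M.Admissible t (fun _ => T) π) :
    ∀ᵐ ω ∂μ, IntegrableOn (fun r : ℝ => π r.toNNReal ω * M.θ r.toNNReal ω) (Ioc (t : ℝ) T) := by
  obtain ⟨hp, C, hC, hC'⟩ := h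
  have hu := measurable_uncurry_of_isProgressive hp
  have hσ : IsStoppingTime M.𝓕 (fun _ : Ω => ((t : ℝ≥0) : WithTop ℝ≥0)) := isStoppingTime_const _ _
  have hX := measurable_setLIntegral_enorm_sq hu (measurable_const (a := t)) T
  have hbd := hC' (fun _ => t) hσ fun ω => ⟨le_rfl, htT⟩
  have hint : ∫⁻ ω, (∫⁻ r in Ioc (t : ℝ) T, ‖π r.toNNReal ω‖ₑ ^ 2) ∂μ ≠ ⊤ := by
    rw [← lintegral_condLExp hσ.measurableSpace_le]
    refine ne_top_of_le_ne_top ?_ (lintegral_mono_ae hbd)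
    simp [ENNReal.mul_eq_top]
  obtain ⟨D, hD⟩ := M.bounded_risk
  filter_upwards [ae_lt_top hX hint] with ω hω
  have hπ : Measurable fun r : ℝ => π r.toNNReal ω :=
    (measurable_uncurry_comp_toNNReal hu).comp (measurable_prodMk_left (x := ω))
  have hθ : Measurable fun r : ℝ => M.θ r.toNNReal ω :=
    (measurable_uncurry_comp_toNNReal M.measurable_uncurry_θ).comp
      (measurable_prodMk_left (x := ω))
  have hL2 : MemLp (fun r : ℝ => π r.toNNReal ω) 2 (volume.restrict (Ioc (t : ℝ) T)) := by
    refine ⟨hπ.aestronglyMeasurable, ?_⟩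
    rw [eLpNorm_lt_top_iff_lintegral_rpow_enorm_lt_top (by simp) (by simp)]
    simpa using hω
  exact (hL2.integrable (by norm_num)).mul_bdd (c := D) hθ.aestronglyMeasurable
    (Eventually.of_forall fun r => hD _ _)

/-- Gains of admissible strategies are linear over bounded random variables known at time `t`. -/
theorem IsGain.combine [IsFiniteMeasure μ] (htT : t ≤ T) {π₁ π₂ : ℝ≥0 → Ω → ℝ} {G₁ G₂ : Ω → ℝ}
    (h₁ : M.Admissible t (fun _ => T) π₁) (h₂ : M.Admissible t (fun _ => T) π₂)
    (hG₁ : M.IsGain t (fun _ => T) π₁ G₁) (hG₂ : M.IsGain t (fun _ => T) π₂ G₂) {a b : Ω → ℝ}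
    (ha : Measurable[M.𝓕 t] a) (hb : Measurable[M.𝓕 t] b) {K : ℝ} (haK : ∀ ω, |a ω| ≤ K)
    (hbK : ∀ ω, |b ω| ≤ K) :
    M.IsGain t (fun _ => T) (combineAfter t a b π₁ π₂) fun ω => a ω * G₁ ω + b ω * G₂ ω := by
  obtain ⟨I₁, hI₁, e₁⟩ := hG₁
  obtain ⟨I₂, hI₂, e₂⟩ := hG₂
  have hm : ∀ {π : ℝ≥0 → Ω → ℝ}, IsProgressive M.𝓕 π →
      Measurable (Function.uncurry fun r ω => (Iic T).indicator (fun s => π s ω) r) := fun hπ =>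
    (measurable_uncurry_of_isProgressive hπ).indicator (measurable_fst measurableSet_Iic)
  refine ⟨_, hI₁.combine (M.measurable_W 0) hI₂ (hm h₁.1) (hm h₂.1) ha hb haK hbK
    (fun r ω hr => ?_), ?_⟩
  · by_cases hT : r ∈ Iic T <;> simp [hT, combineAfter_of_lt hr]
  · filter_upwards [e₁, e₂, h₁.integrableOn_mul_θ htT, h₂.integrableOn_mul_θ htT]
      with ω e₁ e₂ i₁ i₂
    have : ∫ r in Ioc (t : ℝ) T, combineAfter t a b π₁ π₂ r.toNNReal ω * M.θ r.toNNReal ω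
        = ∫ r in Ioc (t : ℝ) T, (a ω * (π₁ r.toNNReal ω * M.θ r.toNNReal ω)
          + b ω * (π₂ r.toNNReal ω * M.θ r.toNNReal ω)) := by
      refine setIntegral_congr_fun measurableSet_Ioc fun r hr => ?_
      have hr' : t < r.toNNReal := by rw [Real.lt_toNNReal_iff_coe_lt]; exact hr.1
      simp only [combineAfter_of_lt hr']
      ring
    rw [e₁, e₂, this, integral_add (i₁.const_mul _) (i₂.const_mul _), integral_const_mul,
      integral_const_mul]
    ring

theorem IsGain.aemeasurable {π : ℝ≥0 → Ω → ℝ} {G : Ω → ℝ} (hπ : IsProgressive M.𝓕 π)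
    (hG : M.IsGain t (fun _ => T) π G) : AEMeasurable G μ := by
  obtain ⟨I, hI, e⟩ := hG
  refine ⟨_, ?_, e⟩
  have h : Measurable fun p : Ω × ℝ => π p.2.toNNReal p.1 * M.θ p.2.toNNReal p.1 :=
    (measurable_uncurry_comp_toNNReal (measurable_uncurry_of_isProgressive hπ)).mul
      (measurable_uncurry_comp_toNNReal M.measurable_uncurry_θ)
  exact (h.stronglyMeasurable.integral_prod_right'
    (ν := volume.restrict (Ioc (t : ℝ) T))).measurable.add hI.1

end Gains

/-! ### Integrability classes of initial wealth -/

section Wealth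

variable {Ω : Type*} {m0 : MeasurableSpace Ω} {μ : Measure Ω} [μ.IsComplete] {M : Market μ}
  {t : ℝ≥0}

theorem zero_mem_LpAll : (0 : Ω → ℝ) ∈ M.LpAll t :=
  ⟨measurable_const, fun _ _ => MemLp.zero⟩

theorem add_mem_LpAll [IsFiniteMeasure μ] {ξ c : Ω → ℝ} (hξ : ξ ∈ M.LpAll t)
    (hc : c ∈ M.LInfty t) : ξ + c ∈ M.LpAll t := by
  obtain ⟨hcm, C, hC⟩ := hc
  exact ⟨hξ.1.add hcm, fun p hp => (hξ.2 p hp).add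
    (MemLp.of_bound (hcm.mono (M.𝓕.le t) le_rfl).aestronglyMeasurable C hC)⟩

theorem neg_mem_LInfty {c : Ω → ℝ} (hc : c ∈ M.LInfty t) : -c ∈ M.LInfty t := by
  obtain ⟨hcm, C, hC⟩ := hc
  exact ⟨hcm.neg, C, by simpa using hC⟩

theorem combine_mem_LpAll {ξ₁ ξ₂ : Ω → ℝ} (h₁ : ξ₁ ∈ M.LpAll t) (h₂ : ξ₂ ∈ M.LpAll t)
    {a b : Ω → ℝ} (ha : Measurable[M.𝓕 t] a) (hb : Measurable[M.𝓕 t] b) {K : ℝ}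
    (haK : ∀ ω, |a ω| ≤ K) (hbK : ∀ ω, |b ω| ≤ K) :
    (fun ω => a ω * ξ₁ ω + b ω * ξ₂ ω) ∈ M.LpAll t :=
  have hmul : ∀ {a ξ : Ω → ℝ}, ξ ∈ M.LpAll t → Measurable[M.𝓕 t] a → (∀ ω, |a ω| ≤ K) →
      ∀ p : ℝ≥0, 1 ≤ p → MemLp (fun ω => a ω * ξ ω) p μ := fun hξ ha haK p hp =>
    (hξ.2 p hp).of_le_mul ((ha.mul hξ.1).mono (M.𝓕.le t) le_rfl).aestronglyMeasurable
      (Eventually.of_forall fun ω => by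
        rw [norm_mul]
        exact mul_le_mul_of_nonneg_right (haK ω) (norm_nonneg _))
  ⟨(ha.mul h₁.1).add (hb.mul h₂.1), fun p hp => (hmul h₁ ha haK p hp).add (hmul h₂ hb hbK p hp)⟩

end Wealth

end Market

/-! ### Utility functions with bounded risk tolerance -/

/-- If the risk tolerance `-u'/u''` is at most `C`, then `exp (x / C) * u' x` is nonincreasing, so
that `u'` satisfies the Inada conditions and takes the value `y`; a point where it does so maximizes
the concave function `x ↦ u x - x y`. -/
theorem exists_forall_sub_mul_le {u : ℝ → ℝ} (hu : ContDiff ℝ 3 u) (hmono : StrictMono u)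
    {c C : ℝ} (hc : 0 < c)
    (h : ∀ x, c ≤ -(deriv u x / iteratedDeriv 2 u x) ∧ -(deriv u x / iteratedDeriv 2 u x) ≤ C)
    {y : ℝ} (hy : 0 < y) : ∃ B : ℝ, ∀ x, u x - x * y ≤ B := by
  have hC : 0 < C := hc.trans_le ((h 0).1.trans (h 0).2)
  have hdu : Differentiable ℝ u := hu.differentiable (by norm_num)
  have hu1 : ContDiff ℝ 2 (deriv u) := by
    have : ContDiff ℝ (2 + 1) u := by convert hu; norm_num
    exact (contDiff_succ_iff_deriv.1 this).2.2
  have hddu : Differentiable ℝ (deriv u) := hu1.differentiable (by norm_num)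
  have h2 : iteratedDeriv 2 u = deriv (deriv u) := by
    rw [iteratedDeriv_succ, iteratedDeriv_one]
  simp only [h2] at h
  have hpos : ∀ x, 0 < deriv u x := fun x => by
    refine lt_of_le_of_ne hmono.monotone.deriv_nonneg fun h0 => ?_
    have := (h x).1
    rw [← h0] at this
    simp at this
    linarith
  have hneg : ∀ x, deriv (deriv u) x < 0 := fun x => by
    by_contra! hn
    have := div_nonneg (hpos x).le hn
    linarith [(h x).1]
  have hineq : ∀ x, deriv u x + C * deriv (deriv u) x ≤ 0 := fun x => by
    have h1 := (h x).2
    rw [← div_neg, div_le_iff₀ (neg_pos.2 (hneg x))] at h1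
    linarith
  have hanti : Antitone fun x => Real.exp (x / C) * deriv u x := by
    have hd : ∀ x, HasDerivAt (fun x => Real.exp (x / C) * deriv u x)
        (Real.exp (x / C) * (1 / C) * deriv u x + Real.exp (x / C) * deriv (deriv u) x) x :=
      fun x => ((hasDerivAt_id x).div_const C).exp.mul (hddu x).hasDerivAt
    refine antitone_of_deriv_nonpos (fun x => (hd x).differentiableAt) fun x => ?_
    rw [(hd x).deriv]
    have : Real.exp (x / C) * (1 / C) * deriv u x + Real.exp (x / C) * deriv (deriv u) x
        = Real.exp (x / C) / C * (deriv u x + C * deriv (deriv u) x) := by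
      field_simp
    rw [this]
    exact mul_nonpos_of_nonneg_of_nonpos (by positivity) (hineq x)
  have h0 : 0 < deriv u 0 := hpos 0
  -- `u' x = y` would hold at this point if `exp (x / C) * u' x` were constant.
  let z : ℝ := C * Real.log (deriv u 0 / y)
  have hz : Real.exp (z / C) = deriv u 0 / y := by
    rw [mul_div_cancel_left₀ _ hC.ne', Real.exp_log (by positivity)]
  obtain ⟨x₀, hx₀⟩ : y ∈ range (deriv u) := by
    refine mem_range_of_exists_le_of_exists_ge hddu.continuous ⟨max z 0, ?_⟩ ⟨min z 0, ?_⟩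
    · have h1 := hanti (le_max_right z 0)
      have h3 : deriv u 0 / y ≤ Real.exp (max z 0 / C) := by
        rw [← hz]; exact Real.exp_le_exp.2 (by gcongr; exact le_max_left _ _)
      simp only [zero_div, Real.exp_zero, one_mul] at h1
      have h4 := (mul_le_mul_of_nonneg_right h3 (hpos (max z 0)).le).trans h1
      rw [div_mul_eq_mul_div, div_le_iff₀ hy] at h4
      exact le_of_mul_le_mul_left h4 h0
    · have h1 := hanti (min_le_right z 0)
      have h3 : Real.exp (min z 0 / C) ≤ deriv u 0 / y := by
        rw [← hz]; exact Real.exp_le_exp.2 (by gcongr; exact min_le_left _ _)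
      simp only [zero_div, Real.exp_zero, one_mul] at h1
      have h4 := h1.trans (mul_le_mul_of_nonneg_right h3 (hpos (min z 0)).le)
      rw [div_mul_eq_mul_div, le_div_iff₀ hy] at h4
      exact le_of_mul_le_mul_left h4 h0
  have hu'anti : Antitone (deriv u) := antitone_of_deriv_nonpos hddu fun x => (hneg x).le
  have hd : ∀ x, HasDerivAt (fun x => u x - x * y) (deriv u x - 1 * y) x := fun x =>
    (hdu x).hasDerivAt.sub ((hasDerivAt_id x).mul_const y)
  have hcont : Continuous fun x => u x - x * y :=
    continuous_iff_continuousAt.2 fun x => (hd x).continuousAt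
  refine ⟨u x₀ - x₀ * y, fun x => ?_⟩
  rcases le_total x x₀ with hx | hx
  · refine monotoneOn_of_deriv_nonneg (convex_Iic x₀) hcont.continuousOn
      (fun w _ => (hd w).differentiableAt.differentiableWithinAt) (fun w hw => ?_) hx self_mem_Iic hx
    rw [interior_Iic] at hw
    rw [(hd w).deriv, ← hx₀]
    linarith [hu'anti (le_of_lt hw)]
  · refine antitoneOn_of_deriv_nonpos (convex_Ici x₀) hcont.continuousOn
      (fun w _ => (hd w).differentiableAt.differentiableWithinAt) (fun w hw => ?_)
      self_mem_Ici hx hx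
    rw [interior_Ici] at hw
    rw [(hd w).deriv, ← hx₀]
    linarith [hu'anti (le_of_lt hw)]

/-! ### Evaluation of random fields, and arithmetic with infinite values -/

/-- A random field that is almost surely continuous can be evaluated at a random point. -/
theorem aemeasurable_randomField_comp {Ω : Type*} {m0 : MeasurableSpace Ω} {μ : Measure Ω}
    {V : ℝ → Ω → ℝ} (hV : ∀ x, Measurable (V x)) (hcont : ∀ᵐ ω ∂μ, Continuous fun x => V x ω)
    {X : Ω → ℝ} (hX : AEMeasurable X μ) : AEMeasurable (fun ω => V (X ω) ω) μ := by
  classical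
  let N : Set Ω := toMeasurable μ {ω | ¬Continuous fun x => V x ω}
  have hN : ∀ᵐ ω ∂μ, ω ∉ N := by
    rw [ae_iff] at hcont ⊢
    simpa [N, measure_toMeasurable] using hcont
  let V' : ℝ → Ω → ℝ := fun x ω => if ω ∈ N then 0 else V x ω
  have hV' : Measurable (Function.uncurry V') := by
    refine measurable_uncurry_of_continuous_of_measurable (fun ω => ?_) fun x => ?_
    · by_cases hω : ω ∈ N
      · simpa [V', hω] using continuous_const
      · have : Continuous fun x => V x ω := by
          by_contra hc
          exact hω (subset_toMeasurable _ _ hc)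
        simpa [V', hω] using this
    · exact Measurable.ite (measurableSet_toMeasurable _ _) measurable_const (hV x)
  refine (hV'.comp_aemeasurable (hX.prodMk aemeasurable_id)).congr ?_
  filter_upwards [hN] with ω hω
  simp [Function.uncurry, V', hω]

theorem ereal_sub_coe_sub (a : EReal) (p q : ℝ) :
    a - ((p - q : ℝ) : EReal) = a - (p : EReal) + (q : EReal) := by
  induction a with
  | bot => simp
  | top => rw [EReal.top_sub_coe, EReal.top_sub_coe, EReal.top_add_coe]
  | coe a => norm_cast; ring

namespace Market

variable {Ω : Type*} {m0 : MeasurableSpace Ω} {μ : Measure Ω} [μ.IsComplete] [IsFiniteMeasure μ]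
  {M : Market μ} {U : ℝ≥0 → ℝ → Ω → ℝ} {t T : ℝ≥0}

/-! ### The value of optimal investment -/

theorem isEssSup_primalValue (M : Market μ) (U : ℝ≥0 → ℝ → Ω → ℝ) (t T : ℝ≥0) (P ξ : Ω → ℝ) :
    IsEssSup μ (M.𝓕 t) {Y | ∃ (π : ℝ≥0 → Ω → ℝ) (G : Ω → ℝ), M.Admissible t (fun _ => T) π ∧
      M.IsGain t (fun _ => T) π G ∧
      Y = genCondExp μ (M.𝓕 t) (fun ω => U T (ξ ω + G ω + P ω) ω)}
      (M.primalValue U t (fun _ => T) P ξ) :=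
  isEssSup_essSupFamily μ (M.𝓕.le t) _

theorem isEssSup_forwardOCE (M : Market μ) (U : ℝ≥0 → ℝ → Ω → ℝ) (t T : ℝ≥0) (η P : Ω → ℝ) :
    IsEssSup μ (M.𝓕 t) {Y | ∃ ξ ∈ M.LpAll t,
      Y = fun ω => M.primalValue U t (fun _ => T) P ξ ω - ((ξ ω * η ω : ℝ) : EReal)}
      (M.forwardOCE U t T η P) :=
  isEssSup_essSupFamily μ (M.𝓕.le t) _

theorem primalValue_mono (hU : ∀ᵐ ω ∂μ, StrictMono fun x => U T x ω) {P₁ P₂ : Ω → ℝ}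
    (h : P₂ ≤ᵐ[μ] P₁) (ξ : Ω → ℝ) :
    M.primalValue U t (fun _ => T) P₂ ξ ≤ᵐ[μ] M.primalValue U t (fun _ => T) P₁ ξ := by
  refine (isEssSup_primalValue M U t T P₂ ξ).mono (isEssSup_primalValue M U t T P₁ ξ) ?_
  rintro _ ⟨π, G, hπ, hG, rfl⟩
  refine ⟨_, ⟨π, G, hπ, hG, rfl⟩, genCondExp_mono ?_⟩
  filter_upwards [hU, h] with ω hω hP
  exact hω.monotone (by linarith)

theorem primalValue_add_right (P ξ c : Ω → ℝ) :
    M.primalValue U t (fun _ => T) (P + c) ξ = M.primalValue U t (fun _ => T) P (ξ + c) := by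
  have : ∀ G : Ω → ℝ, (fun ω => U T (ξ ω + G ω + (P + c) ω) ω)
      = fun ω => U T ((ξ + c) ω + G ω + P ω) ω := fun G => by
    funext ω
    congr 1
    simp only [Pi.add_apply]
    ring
  simp only [primalValue, this]

/-- Adding the gain of an admissible strategy to the endowment only shifts the strategies. -/
theorem primalValue_add_gain (htT : t ≤ T) {π : ℝ≥0 → Ω → ℝ} {G : Ω → ℝ}
    (hπ : M.Admissible t (fun _ => T) π) (hG : M.IsGain t (fun _ => T) π G) (P ξ : Ω → ℝ) :
    M.primalValue U t (fun _ => T) (P + G) ξ = M.primalValue U t (fun _ => T) P ξ := by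
  unfold primalValue
  congr 1
  ext Y
  have h1 : Measurable[M.𝓕 t] fun _ : Ω => (1 : ℝ) := measurable_const
  have h1' : Measurable[M.𝓕 t] fun _ : Ω => (-1 : ℝ) := measurable_const
  constructor
  · rintro ⟨π', G', hπ', hG', rfl⟩
    refine ⟨_, _, hπ'.combine hπ h1 h1 (K := 1) (by simp) (by simp),
      IsGain.combine htT hπ' hπ hG' hG h1 h1 (K := 1) (by simp) (by simp), ?_⟩
    congr 1
    funext ω
    congr 1
    simp only [Pi.add_apply]
    ring
  · rintro ⟨π', G', hπ', hG', rfl⟩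
    refine ⟨_, _, hπ'.combine hπ h1 h1' (K := 1) (by simp) (by simp),
      IsGain.combine htT hπ' hπ hG' hG h1 h1' (K := 1) (by simp) (by simp), ?_⟩
    congr 1
    funext ω
    congr 1
    simp only [Pi.add_apply]
    ring

/-- Joint concavity of the value of optimal investment in endowment and initial wealth, for random
weights known at time `t`. -/
theorem primalValue_concave (htT : t ≤ T) (hprog : ∀ x, IsProgressive M.𝓕 fun s ω => U s x ω)
    (hconc : ∀ᵐ ω ∂μ, ConcaveOn ℝ univ fun x => U T x ω)
    (hcont : ∀ᵐ ω ∂μ, Continuous fun x => U T x ω) {P₁ P₂ ξ₁ ξ₂ : Ω → ℝ}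
    (hP₁ : Measurable P₁) (hP₂ : Measurable P₂) (hξ₁ : Measurable ξ₁) (hξ₂ : Measurable ξ₂)
    {l : Ω → ℝ} (hl : Measurable[M.𝓕 t] l) (hl01 : ∀ ω, l ω ∈ Ioo (0 : ℝ) 1) :
    ∀ᵐ ω ∂μ, (l ω : EReal) * M.primalValue U t (fun _ => T) P₁ ξ₁ ω
      + ((1 - l ω : ℝ) : EReal) * M.primalValue U t (fun _ => T) P₂ ξ₂ ω
      ≤ M.primalValue U t (fun _ => T) (fun ω => l ω * P₁ ω + (1 - l ω) * P₂ ω)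
        (fun ω => l ω * ξ₁ ω + (1 - l ω) * ξ₂ ω) ω := by
  have hl' : Measurable[M.𝓕 t] fun ω => 1 - l ω := measurable_const.sub hl
  have hK : ∀ ω, |l ω| ≤ 1 := fun ω => abs_le.2 ⟨by linarith [(hl01 ω).1], (hl01 ω).2.le⟩
  have hK' : ∀ ω, |1 - l ω| ≤ 1 := fun ω =>
    abs_le.2 ⟨by linarith [(hl01 ω).2], by linarith [(hl01 ω).1]⟩
  refine (isEssSup_primalValue M U t T P₁ ξ₁).mul_add_mul_le (isEssSup_primalValue M U t T P₂ ξ₂)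
    ?_ hl (fun ω => (hl01 ω).1) hl' (fun ω => by linarith [(hl01 ω).2])
    (isEssSup_primalValue M U t T _ _).measurable ?_
  · rintro _ ⟨π, G, -, -, rfl⟩
    exact measurable_genCondExp _
  rintro _ ⟨π₁, G₁, hπ₁, hG₁, rfl⟩ _ ⟨π₂, G₂, hπ₂, hG₂, rfl⟩
  have hUm : ∀ x, Measurable (U T x) := fun x => ((hprog x).adapted T).mono (M.𝓕.le T) le_rfl
  have hX₁ : AEMeasurable (fun ω => U T (ξ₁ ω + G₁ ω + P₁ ω) ω) μ :=
    aemeasurable_randomField_comp hUm hcont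
      ((hξ₁.aemeasurable.add (hG₁.aemeasurable hπ₁.1)).add hP₁.aemeasurable)
  have hX₂ : AEMeasurable (fun ω => U T (ξ₂ ω + G₂ ω + P₂ ω) ω) μ :=
    aemeasurable_randomField_comp hUm hcont
      ((hξ₂.aemeasurable.add (hG₂.aemeasurable hπ₂.1)).add hP₂.aemeasurable)
  have hsup := (isEssSup_primalValue M U t T (fun ω => l ω * P₁ ω + (1 - l ω) * P₂ ω)
    (fun ω => l ω * ξ₁ ω + (1 - l ω) * ξ₂ ω)).le _
    ⟨_, _, hπ₁.combine hπ₂ hl hl' hK hK', IsGain.combine htT hπ₁ hπ₂ hG₁ hG₂ hl hl' hK hK', rfl⟩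
  have e₁ := genCondExp_mul (M.𝓕.le t) hl (fun ω => (hl01 ω).1.le) hX₁
  have e₂ := genCondExp_mul (M.𝓕.le t) hl' (fun ω => by linarith [(hl01 ω).2]) hX₂
  have hadd := genCondExp_add_le (m := M.𝓕 t)
    ((hl.mono (M.𝓕.le t) le_rfl).aemeasurable.mul hX₁)
    ((hl'.mono (M.𝓕.le t) le_rfl).aemeasurable.mul hX₂)
  have hmono : genCondExp μ (M.𝓕 t) (fun ω => l ω * U T (ξ₁ ω + G₁ ω + P₁ ω) ω
        + (1 - l ω) * U T (ξ₂ ω + G₂ ω + P₂ ω) ω) ≤ᵐ[μ]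
      genCondExp μ (M.𝓕 t) fun ω => U T ((l ω * ξ₁ ω + (1 - l ω) * ξ₂ ω)
        + (l ω * G₁ ω + (1 - l ω) * G₂ ω) + (l ω * P₁ ω + (1 - l ω) * P₂ ω)) ω := by
    refine genCondExp_mono ?_
    filter_upwards [hconc] with ω hω
    have := hω.2 (mem_univ (ξ₁ ω + G₁ ω + P₁ ω)) (mem_univ (ξ₂ ω + G₂ ω + P₂ ω)) (hl01 ω).1.le
      (by linarith [(hl01 ω).2] : 0 ≤ 1 - l ω) (by ring)
    simp only [smul_eq_mul] at this
    refine this.trans_eq (congrArg (U T · ω) ?_)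
    ring
  filter_upwards [hsup, e₁, e₂, hadd, hmono] with ω hsup e₁ e₂ hadd hmono
  rw [← e₁, ← e₂]
  exact (hadd.trans hmono).trans hsup

/-! ### Properties of the forward optimized certainty equivalent -/

theorem forwardOCE_mono (hU : ∀ᵐ ω ∂μ, StrictMono fun x => U T x ω) (η : Ω → ℝ) {P₁ P₂ : Ω → ℝ}
    (h : P₂ ≤ᵐ[μ] P₁) : M.forwardOCE U t T η P₂ ≤ᵐ[μ] M.forwardOCE U t T η P₁ := by
  refine (isEssSup_forwardOCE M U t T η P₂).mono (isEssSup_forwardOCE M U t T η P₁) ?_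
  rintro _ ⟨ξ, hξ, rfl⟩
  refine ⟨_, ⟨ξ, hξ, rfl⟩, ?_⟩
  filter_upwards [primalValue_mono (M := M) (t := t) hU h ξ] with ω hω
  exact EReal.sub_le_sub hω le_rfl

theorem forwardOCE_add_le {η : Ω → ℝ} (hη : Measurable[M.𝓕 t] η) (P : Ω → ℝ) {c : Ω → ℝ}
    (hc : c ∈ M.LInfty t) : M.forwardOCE U t T η (P + c) ≤ᵐ[μ]
      fun ω => M.forwardOCE U t T η P ω + ((η ω * c ω : ℝ) : EReal) := by
  refine (isEssSup_forwardOCE M U t T η (P + c)).least _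
    ((isEssSup_forwardOCE M U t T η P).measurable.add (hη.mul hc.1).coe_real_ereal) ?_
  rintro _ ⟨ξ, hξ, rfl⟩
  filter_upwards [(isEssSup_forwardOCE M U t T η P).le _ ⟨ξ + c, add_mem_LpAll hξ hc, rfl⟩]
    with ω hω
  have e : ξ ω * η ω = (ξ + c) ω * η ω - η ω * c ω := by simp only [Pi.add_apply]; ring
  rw [primalValue_add_right, e, ereal_sub_coe_sub]
  exact add_le_add_left hω _

/-- Cash invariance; the lower bound is the upper bound for the endowment `P + c` and cash `-c`. -/
theorem forwardOCE_add {η : Ω → ℝ} (hη : Measurable[M.𝓕 t] η) (P : Ω → ℝ) {c : Ω → ℝ}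
    (hc : c ∈ M.LInfty t) : M.forwardOCE U t T η (P + c) =ᵐ[μ]
      fun ω => M.forwardOCE U t T η P ω + ((η ω * c ω : ℝ) : EReal) := by
  have h₂ := forwardOCE_add_le (U := U) (T := T) hη (P + c) (neg_mem_LInfty hc)
  rw [add_neg_cancel_right] at h₂
  filter_upwards [forwardOCE_add_le (U := U) (T := T) hη P hc, h₂] with ω h₁ h₂
  refine le_antisymm h₁ ((add_le_add_left h₂ _).trans_eq ?_)
  rw [Pi.neg_apply, mul_neg, EReal.coe_neg, ← sub_eq_add_neg, EReal.sub_add_cancel]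

theorem forwardOCE_concave (htT : t ≤ T) (hprog : ∀ x, IsProgressive M.𝓕 fun s ω => U s x ω)
    (hconc : ∀ᵐ ω ∂μ, ConcaveOn ℝ univ fun x => U T x ω)
    (hcont : ∀ᵐ ω ∂μ, Continuous fun x => U T x ω) {η : Ω → ℝ} (hη : Measurable[M.𝓕 t] η)
    {P₁ P₂ : Ω → ℝ} (hP₁ : Measurable P₁) (hP₂ : Measurable P₂)
    {l : Ω → ℝ} (hl : Measurable[M.𝓕 t] l) (hl01 : ∀ ω, l ω ∈ Ioo (0 : ℝ) 1) :
    ∀ᵐ ω ∂μ, (l ω : EReal) * M.forwardOCE U t T η P₁ ω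
      + ((1 - l ω : ℝ) : EReal) * M.forwardOCE U t T η P₂ ω
      ≤ M.forwardOCE U t T η (fun ω => l ω * P₁ ω + (1 - l ω) * P₂ ω) ω := by
  have hl' : Measurable[M.𝓕 t] fun ω => 1 - l ω := measurable_const.sub hl
  have hK : ∀ ω, |l ω| ≤ 1 := fun ω => abs_le.2 ⟨by linarith [(hl01 ω).1], (hl01 ω).2.le⟩
  have hK' : ∀ ω, |1 - l ω| ≤ 1 := fun ω =>
    abs_le.2 ⟨by linarith [(hl01 ω).2], by linarith [(hl01 ω).1]⟩
  refine (isEssSup_forwardOCE M U t T η P₁).mul_add_mul_le (isEssSup_forwardOCE M U t T η P₂)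
    ?_ hl (fun ω => (hl01 ω).1) hl' (fun ω => by linarith [(hl01 ω).2])
    (isEssSup_forwardOCE M U t T η _).measurable ?_
  · rintro _ ⟨ξ, hξ, rfl⟩
    simp_rw [sub_eq_add_neg]
    exact (isEssSup_primalValue M U t T P₂ ξ).measurable.add (hξ.1.mul hη).coe_real_ereal.neg
  rintro _ ⟨ξ₁, hξ₁, rfl⟩ _ ⟨ξ₂, hξ₂, rfl⟩
  filter_upwards [(isEssSup_forwardOCE M U t T η (fun ω => l ω * P₁ ω + (1 - l ω) * P₂ ω)).le _
      ⟨_, combine_mem_LpAll hξ₁ hξ₂ hl hl' hK hK', rfl⟩,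
    primalValue_concave htT hprog hconc hcont hP₁ hP₂ (hξ₁.1.mono (M.𝓕.le t) le_rfl)
      (hξ₂.1.mono (M.𝓕.le t) le_rfl) hl hl01] with ω h₁ h₂
  refine le_trans ?_ ((EReal.sub_le_sub h₂ le_rfl).trans h₁)
  have hl0 : (0 : EReal) ≤ (l ω : EReal) := by exact_mod_cast (hl01 ω).1.le
  have hl1 : (0 : EReal) ≤ ((1 - l ω : ℝ) : EReal) := by
    exact_mod_cast (by linarith [(hl01 ω).2] : (0 : ℝ) ≤ 1 - l ω)
  rw [EReal.mul_sub_of_nonneg_of_ne_top hl0 (EReal.coe_ne_top _),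
    EReal.mul_sub_of_nonneg_of_ne_top hl1 (EReal.coe_ne_top _), ← EReal.coe_mul, ← EReal.coe_mul,
    ← EReal.add_sub_add_comm (Or.inl (EReal.coe_ne_bot _)) (Or.inl (EReal.coe_ne_top _)),
    ← EReal.coe_add]
  refine EReal.sub_le_sub le_rfl (EReal.coe_le_coe_iff.2 (le_of_eq ?_))
  ring

theorem forwardOCE_add_gain (htT : t ≤ T) {π : ℝ≥0 → Ω → ℝ} {G : Ω → ℝ}
    (hπ : M.Admissible t (fun _ => T) π) (hG : M.IsGain t (fun _ => T) π G) (η P : Ω → ℝ) :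
    M.forwardOCE U t T η (P + G) = M.forwardOCE U t T η P := by
  simp only [forwardOCE, primalValue_add_gain htT hπ hG]

/-- Without endowment the forward optimized certainty equivalent is finite: by self-generation it
is at most the value at `η` of the convex conjugate of `U(t, ·)`, which bounded risk tolerance makes
finite. The conjugate is written as a supremum over rational wealth, to be measurable. -/
theorem forwardOCE_zero_finite (hU : M.IsForwardPerformance U)
    (hreg : ∀ s, ∀ᵐ ω ∂μ, ContDiff ℝ 3 fun x => U s x ω)
    (hrisk : ∃ Cl Cu : ℝ, 0 < Cl ∧ ∀ᵐ ω ∂μ, ∀ s x,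
      Cl ≤ -(deriv (fun y => U s y ω) x / iteratedDeriv 2 (fun y => U s y ω) x) ∧
      -(deriv (fun y => U s y ω) x / iteratedDeriv 2 (fun y => U s y ω) x) ≤ Cu)
    (htT : t ≤ T) {η : Ω → ℝ} (hη : Measurable[M.𝓕 t] η) (hη0 : ∀ᵐ ω ∂μ, 0 < η ω) :
    ∀ᵐ ω ∂μ, M.forwardOCE U t T η 0 ω ≠ ⊥ ∧ M.forwardOCE U t T η 0 ω ≠ ⊤ := by
  obtain ⟨Cl, Cu, hCl, hrisk⟩ := hrisk
  have hself := fun ξ hξ => hU.selfGeneration (fun _ => T) (isStoppingTime_const _ _)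
    ⟨T, fun _ => le_rfl⟩ t (fun _ => htT) ξ hξ
  let V : Ω → EReal := fun ω => ⨆ q : ℚ, ((U t q ω - q * η ω : ℝ) : EReal)
  have hV : Measurable[M.𝓕 t] V := Measurable.iSup fun q =>
    (((hU.progressive q).adapted t).sub (measurable_const.mul hη)).coe_real_ereal
  have hle : M.forwardOCE U t T η 0 ≤ᵐ[μ] V := by
    refine (isEssSup_forwardOCE M U t T η 0).least V hV ?_
    rintro _ ⟨ξ, hξ, rfl⟩
    filter_upwards [hself ξ hξ, hreg t] with ω h₁ h₂
    rw [← h₁, ← EReal.coe_sub]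
    have hc : Continuous fun x : ℝ => ((U t x ω - x * η ω : ℝ) : EReal) :=
      continuous_coe_real_ereal.comp (h₂.continuous.sub (continuous_id.mul continuous_const))
    exact Rat.denseRange_cast.induction_on
      (p := fun x : ℝ => ((U t x ω - x * η ω : ℝ) : EReal) ≤ V ω)
      (ξ ω) (isClosed_le hc continuous_const)
      fun q => le_iSup (fun q : ℚ => ((U t q ω - q * η ω : ℝ) : EReal)) q
  filter_upwards [hle, hself 0 zero_mem_LpAll,
    (isEssSup_forwardOCE M U t T η 0).le _ ⟨0, zero_mem_LpAll, rfl⟩,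
    hreg t, hrisk, hU.strictMono t, hη0] with ω h₁ h₂ h₃ h₄ h₅ h₆ h₇
  constructor
  · rw [← h₂, ← EReal.coe_sub] at h₃
    exact ne_bot_of_le_ne_bot (EReal.coe_ne_bot _) h₃
  · obtain ⟨B, hB⟩ := exists_forall_sub_mul_le h₄ h₆ hCl (h₅ t) h₇
    refine ne_top_of_le_ne_top (EReal.coe_ne_top B) (h₁.trans (iSup_le fun q => ?_))
    exact EReal.coe_le_coe_iff.2 (hB q)

end Market

end ForwardOCE

theorem proposition5p4 {Ω : Type*} {m0 : MeasurableSpace Ω} (μ : Measure Ω)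
    [IsProbabilityMeasure μ] [μ.IsComplete] (M : ForwardOCE.Market μ)
    (U : ℝ≥0 → ℝ → Ω → ℝ) (hU : M.IsForwardPerformance U)
    (hreg : ∀ s, ∀ᵐ ω ∂μ, ContDiff ℝ 3 (fun x => U s x ω))
    (hrisk : ∃ Cl Cu : ℝ, 0 < Cl ∧ ∀ᵐ ω ∂μ, ∀ s x,
      Cl ≤ -(deriv (fun y => U s y ω) x / iteratedDeriv 2 (fun y => U s y ω) x) ∧
      -(deriv (fun y => U s y ω) x / iteratedDeriv 2 (fun y => U s y ω) x) ≤ Cu)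
    (T : ℝ≥0) (hT : 0 < T) (t : ℝ≥0) (htT : t ≤ T) (η : Ω → ℝ) (hη : η ∈ M.Deflators t) :
    -- monotonicity
    (∀ P₁ ∈ M.LInfty T, ∀ P₂ ∈ M.LInfty T, P₂ ≤ᵐ[μ] P₁ →
      M.forwardOCE U t T η P₂ ≤ᵐ[μ] M.forwardOCE U t T η P₁) ∧
    -- cash invariance
    (∀ P ∈ M.LInfty T, ∀ c ∈ M.LInfty t,
      M.forwardOCE U t T η (P + c) =ᵐ[μ]
        fun ω => M.forwardOCE U t T η P ω + ((η ω * c ω : ℝ) : EReal)) ∧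
    -- concavity
    (∀ P₁ ∈ M.LInfty T, ∀ P₂ ∈ M.LInfty T, ∀ l : Ω → ℝ, Measurable[M.𝓕 t] l →
      (∀ᵐ ω ∂μ, l ω ∈ Ioo (0 : ℝ) 1) →
      ∀ᵐ ω ∂μ, (l ω : EReal) * M.forwardOCE U t T η P₁ ω
          + ((1 - l ω : ℝ) : EReal) * M.forwardOCE U t T η P₂ ω
        ≤ M.forwardOCE U t T η (fun ω' => l ω' * P₁ ω' + (1 - l ω') * P₂ ω') ω) ∧
    -- replication invariance
    (∀ P ∈ M.LInfty T, ∀ (π : ℝ≥0 → Ω → ℝ) (G : Ω → ℝ),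
      M.Admissible t (fun _ => T) π → M.IsGain t (fun _ => T) π G →
      M.forwardOCE U t T η (P + G) =ᵐ[μ] M.forwardOCE U t T η P) ∧
    -- positivity
    (∀ P ∈ M.LInfty T, 0 ≤ᵐ[μ] P →
      ∀ᵐ ω ∂μ, 0 ≤ M.normForwardOCE U t T η P ω) ∧
    -- constancy
    (∀ c ∈ M.LInfty t,
      M.normForwardOCE U t T η c =ᵐ[μ] fun ω => ((η ω * c ω : ℝ) : EReal)) := by
  have hfin := ForwardOCE.Market.forwardOCE_zero_finite hU hreg hrisk htT hη.1 hη.2.1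
  have hmono := fun {P₁ P₂ : Ω → ℝ} (h : P₂ ≤ᵐ[μ] P₁) =>
    ForwardOCE.Market.forwardOCE_mono (M := M) (t := t) (hU.strictMono T) η h
  have hcash := fun (P : Ω → ℝ) {c : Ω → ℝ} (hc : c ∈ M.LInfty t) =>
    ForwardOCE.Market.forwardOCE_add (U := U) (T := T) hη.1 P hc
  refine ⟨fun P₁ _ P₂ _ h => hmono h, fun P _ c hc => hcash P hc, ?_,
    fun P _ π G hπ hG => by rw [ForwardOCE.Market.forwardOCE_add_gain htT hπ hG], ?_, ?_⟩
  · intro P₁ hP₁ P₂ hP₂ l hl hl01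
    classical
    -- The weight is redefined on a null set, so as to lie in `(0, 1)` everywhere.
    let l' : Ω → ℝ := fun ω => if l ω ∈ Ioo (0 : ℝ) 1 then l ω else 1 / 2
    have hl' : Measurable[M.𝓕 t] l' := Measurable.ite (hl measurableSet_Ioo) hl measurable_const
    have hl'01 : ∀ ω, l' ω ∈ Ioo (0 : ℝ) 1 := fun ω => by
      by_cases h : l ω ∈ Ioo (0 : ℝ) 1
      · simpa only [l', if_pos h] using h
      · simp only [l', if_neg h]
        norm_num
    have hll' : ∀ᵐ ω ∂μ, l' ω = l ω := hl01.mono fun ω h => if_pos h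
    filter_upwards [hll', ForwardOCE.Market.forwardOCE_concave htT hU.progressive
        ((hU.strictConcave T).mono fun ω h => h.concaveOn)
        ((hreg T).mono fun ω h => h.continuous) hη.1 (hP₁.1.mono (M.𝓕.le T) le_rfl)
        (hP₂.1.mono (M.𝓕.le T) le_rfl) hl' hl'01,
      hmono (P₁ := fun ω => l ω * P₁ ω + (1 - l ω) * P₂ ω)
        (P₂ := fun ω => l' ω * P₁ ω + (1 - l' ω) * P₂ ω)
        (hll'.mono fun ω h => by simp only [h, le_refl])] with ω h₁ h₂ h₃
    rw [h₁] at h₂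
    exact h₂.trans h₃
  · intro P _ hP0
    filter_upwards [hfin, hmono hP0] with ω h₁ h₂
    exact (EReal.sub_nonneg (Or.inr h₁.2) (Or.inr h₁.1)).2 h₂
  · intro c hc
    have h := hcash 0 hc
    rw [zero_add] at h
    filter_upwards [hfin, h] with ω h₁ h₂
    rw [ForwardOCE.Market.normForwardOCE, h₂]
    lift M.forwardOCE U t T η 0 ω to ℝ using ⟨h₁.2, h₁.1⟩ with x
    exact EReal.add_sub_cancel_left
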